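/- Let $P$ be a monic complex polynomial of degree $d$ whose roots are all simple, let $Q$ be a complex polynomial of degree $d-1$ that is nonzero at every root of $P$, and let $R(z^{-1}) = \sum_{j\ge 0} R_j z^{-j}$ be holomorphic on a disk $|z| > A$ around $z = \infty$ (these are the data of the level-1 differential operator $P(\partial_z) + z^{-1}Q(\partial_z) + z^{-2}R(z^{-1})$). Let $-\alpha$ be a root of $P$ for which $\tau_\alpha := Q(-\alpha)/P'(-\alpha)$ is real and positive. Let $\Omega_\alpha \subset \mathbb{C}$ be a simply connected open set that does not contain the point $\alpha$, is star-shaped around $\alpha$ (for every $a \in \Omega_\alpha$, the straight path from $\alpha$ to $a$, without its starting point, lies in $\Omega_\alpha$), has $\alpha$ in its closure, and has no other root of $P(-\zeta)$ in its closure. For $\sigma \in \mathbb{R}$, let $E^{\sigma}(\Omega_\alpha)$ be the space of holomorphic functions $f$ on $\Omega_\alpha$ such that, for some constants $C, \Lambda \in \mathbb{R}$, $|f(\zeta)| \le C\,|\zeta-\alpha|^{\sigma} e^{\Lambda|\zeta-\alpha|}$ for all $\zeta \in \Omega_\alpha$. Let $[\partial_{\zeta,\alpha}^{-1}\varphi](a)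 := \int_{\alpha}^{a} \varphi\,d\zeta$ (along the straight path), and let \[ \hat{\mathcal{P}}_\alpha := P(-\zeta) + \partial_{\zeta,\alpha}^{-1}\circ Q(-\zeta) + \partial_{\zeta,\alpha}^{-2}\circ R(\partial_{\zeta,\alpha}^{-1}), \qquad R(\partial_{\zeta,\alpha}^{-1}) := \sum_{j\ge 0} R_j\,\partial_{\zeta,\alpha}^{-j}. \] The integrals and the series defining $\hat{\mathcal{P}}_\alpha\varphi$ converge absolutely at each point of $\Omega_\alpha$ for every $\varphi \in E^{\tau_\alpha-1}(\Omega_\alpha)$. Moreover, $\log(\zeta-\alpha)$ has a holomorphic branch on $\Omega_\alpha$, and for each such branch, with the corresponding branch of $(\zeta-\alpha)^{\tau_\alpha-1}$, the equation \[ \hat{\mathcal{P}}_\alpha\psi_\alpha = 0 \quad\text{on } \Omega_\alpha \] has a unique solution $\psi_\alpha$ in the affine subspace \[ (\zeta-\alpha)^{\tau_\alpha-1} + E^{\tau_\alpha}(\Omega_\alpha) \] of the space $E^{\tau_\alpha-1}(\Omega_\alpha)$. -/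

import Mathlib

open Complex Polynomial MeasureTheory

noncomputable section

namespace LevelOne

/-- `f ∈ E^σ_Λ(Ω)`, with base point `α`: `f` is holomorphic on `Ω` and bounded there by a constant
multiple of `|ζ - α|^σ e^{Λ|ζ - α|}`.  Functions on `Ω` are represented by functions on `ℂ`, whose
values outside `Ω` are irrelevant. -/
def expSpaceOfType (α : ℂ) (Ω : Set ℂ) (σ Λ : ℝ) : Set (ℂ → ℂ) :=
  {f | DifferentiableOn ℂ f Ω ∧
    ∃ C : ℝ, ∀ ζ ∈ Ω, ‖f ζ‖ ≤ C * (‖ζ - α‖ ^ σ * Real.exp (Λ * ‖ζ - α‖))}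

/-- `E^σ(Ω)`, with base point `α`: the union of the spaces `E^σ_Λ(Ω)` over all real `Λ`. -/
def expSpace (α : ℂ) (Ω : Set ℂ) (σ : ℝ) : Set (ℂ → ℂ) :=
  ⋃ Λ : ℝ, expSpaceOfType α Ω σ Λ

/-- `L` is a holomorphic branch of `log (ζ - α)` on `Ω`. -/
def IsLogBranch (α : ℂ) (Ω : Set ℂ) (L : ℂ → ℂ) : Prop :=
  DifferentiableOn ℂ L Ω ∧ ∀ ζ ∈ Ω, Complex.exp (L ζ) = ζ - α

/-- The branch of the power `(ζ - α)^s` that belongs to the branch `L` of `log (ζ - α)`. -/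
def branchPow (L : ℂ → ℂ) (s : ℝ) (ζ : ℂ) : ℂ :=
  Complex.exp ((s : ℂ) * L ζ)

/-- The affine subspace `(ζ - α)^s + E^σ(Ω)`. -/
def affineExpSpace (α : ℂ) (Ω : Set ℂ) (L : ℂ → ℂ) (s σ : ℝ) : Set (ℂ → ℂ) :=
  {ψ | (fun ζ => ψ ζ - branchPow L s ζ) ∈ expSpace α Ω σ}

/-- `Ω` is star-shaped around `α`, a point which need not belong to it: the straight path from `α`
to any point of `Ω` stays in `Ω` (apart from its starting point). -/
def IsStarShapedAround (α : ℂ) (Ω : Set ℂ) : Prop :=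
  ∀ a ∈ Ω, openSegment ℝ α a ⊆ Ω

/-- Integration with base point `α`: `[∂⁻¹ φ](a) = ∫_{ζ = α}^a φ dζ` along the straight path. -/
def baseIntegral (α : ℂ) (φ : ℂ → ℂ) (a : ℂ) : ℂ :=
  ∫ t in (0 : ℝ)..1, φ (α + (t : ℂ) * (a - α)) * (a - α)

/-- The integral of `φ` along the straight path from `α` to `a` converges absolutely. -/
def BaseIntegrable (α : ℂ) (φ : ℂ → ℂ) (a : ℂ) : Prop :=
  IntervalIntegrable (fun t : ℝ => φ (α + (t : ℂ) * (a - α))) volume 0 1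

/-- The coefficient `R_j` in the power series `R(w) = ∑ R_j w^j`. -/
def coeffAt (R : ℂ → ℂ) (j : ℕ) : ℂ :=
  iteratedDeriv j R 0 / (Nat.factorial j : ℂ)

/-- The power series in the integration operator: `R(∂⁻¹) φ = ∑_j R_j ∂^{-j} φ`. -/
def seriesOp (R : ℂ → ℂ) (α : ℂ) (φ : ℂ → ℂ) (a : ℂ) : ℂ :=
  ∑' j : ℕ, coeffAt R j * ((baseIntegral α)^[j] φ) a

/-- The position-domain operator `P(-ζ) + ∂⁻¹ ∘ Q(-ζ) + ∂⁻² ∘ R(∂⁻¹)` with base point `α`. -/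
def positionOp (P Q : ℂ[X]) (R : ℂ → ℂ) (α : ℂ) (φ : ℂ → ℂ) (a : ℂ) : ℂ :=
  P.eval (-a) * φ a
    + baseIntegral α (fun ζ => Q.eval (-ζ) * φ ζ) a
    + baseIntegral α (baseIntegral α (seriesOp R α φ)) a

/-- All integrals and the series in the definition of `positionOp` converge absolutely at `a`. -/
structure PositionOpConverges (Q : ℂ[X]) (R : ℂ → ℂ) (α : ℂ) (φ : ℂ → ℂ) (a : ℂ) : Prop where
  integrable_Q : BaseIntegrable α (fun ζ => Q.eval (-ζ) * φ ζ) a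
  integrable_iterate : ∀ j : ℕ, BaseIntegrable α ((baseIntegral α)^[j] φ) a
  summable : Summable fun j : ℕ => coeffAt R j * ((baseIntegral α)^[j] φ) a
  integrable_series : BaseIntegrable α (seriesOp R α φ) a
  integrable_series_integral : BaseIntegrable α (baseIntegral α (seriesOp R α φ)) a

end LevelOne

end

/-! The operator is multiplication by `P(-ζ)` plus a Volterra operator `V` (`volterraOp`). With `ψ =
p + f`, where `p = (ζ - α)^(τ-1)`, the equation becomes the fixed-point problem `f = -(V f + g) /
P(-ζ)`, where `g` is the image of `p`.

The source is small enough: near `α`, `P(-ζ) ≈ -P'(-α)(ζ - α)` and `Q(-ζ) ≈ τ P'(-α)`, while `p`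
integrates to `(ζ - α)^τ / τ`. The terms of order `τ` cancel, so `g` has order `τ + 1`
(`exists_hasExpBound_positionOp_branchPow`), and dividing by the simple zero of `P(-ζ)` puts `g /
P(-ζ)` in `E^τ`.

The map contracts in the norm of `E^τ_Λ` for large `Λ` (`exists_volterraOp_contraction`). Near `α`,
integrating `|ζ - α|^τ` gives a factor `1/(τ+1)` and `Q/P` contributes about `τ/|ζ - α|`, so the
ratio is about `τ/(τ+1) < 1`; at exponent `τ - 1` it would be `τ/τ = 1`, which is why the correction
is sought in `E^τ`. Away from `α`, `Q/P` is bounded and integration has norm `O(1/Λ)`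
(`mul_integral_rpow_mul_exp_le`). The same smallness makes the series `R(∂⁻¹)` converge and its
contribution negligible.

Existence is the contraction principle `exists_eqOn_of_contraction`. For uniqueness, the difference
of two solutions lies in `E^τ`, and any bound on it improves by the contraction factor indefinitely.
-/

namespace LevelOne

/-! ### Scalar integrals of `t^σ e^{xt}` -/

/-- The constant in the bound `x ∫₀¹ t^σ e^{xt} dt ≤ c e^x`. -/
noncomputable def gainConst (σ : ℝ) : ℝ := 2 ^ |σ| + 1 / (σ + 1)

theorem gainConst_pos {σ : ℝ} (hσ : -1 < σ) : 0 < gainConst σ := by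
  have : 0 < σ + 1 := by linarith
  unfold gainConst; positivity

theorem intervalIntegrable_rpow_mul_exp {σ : ℝ} (hσ : -1 < σ) (x : ℝ) :
    IntervalIntegrable (fun t : ℝ => t ^ σ * Real.exp (x * t)) volume 0 1 :=
  (intervalIntegral.intervalIntegrable_rpow' hσ).mul_continuousOn
    (by fun_prop)

theorem integral_rpow_zero_one {σ : ℝ} (hσ : -1 < σ) :
    ∫ t in (0 : ℝ)..1, t ^ σ = 1 / (σ + 1) := by
  rw [integral_rpow (Or.inl hσ), Real.one_rpow, Real.zero_rpow (by linarith), sub_zero]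

/-- Only `e^{xt} ≤ e^x` is used. The factor `1/(σ+1)` is attained at `x = 0`; with `σ = τ` it
produces the contraction near `α`, where a cruder constant would not do. -/
theorem integral_rpow_mul_exp_le {σ : ℝ} (hσ : -1 < σ) {x : ℝ} (hx : 0 ≤ x) :
    ∫ t in (0 : ℝ)..1, t ^ σ * Real.exp (x * t) ≤ Real.exp x / (σ + 1) := by
  calc ∫ t in (0 : ℝ)..1, t ^ σ * Real.exp (x * t)
      ≤ ∫ t in (0 : ℝ)..1, t ^ σ * Real.exp x := by
        refine intervalIntegral.integral_mono_on zero_le_one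
          (intervalIntegrable_rpow_mul_exp hσ x)
          ((intervalIntegral.intervalIntegrable_rpow' hσ).mul_const _) fun t ht => ?_
        have := Real.rpow_nonneg ht.1 σ
        gcongr
        nlinarith [ht.2]
    _ = _ := by
        rw [intervalIntegral.integral_mul_const, integral_rpow_zero_one hσ]; ring

/-- The integrand is split at `t = 1/2`. Below it, the singular `t^σ` is kept and `x e^{xt} ≤ x
e^{x/2} ≤ e^x`. Above it, `t^σ ≤ 2^|σ|` and `x e^{xt}` integrates to `e^x - 1`. The two majorants
are added, which gives `gainConst`. -/
theorem mul_integral_rpow_mul_exp_le {σ : ℝ} (hσ : -1 < σ) {x : ℝ} (hx : 0 ≤ x) :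
    x * ∫ t in (0 : ℝ)..1, t ^ σ * Real.exp (x * t) ≤ gainConst σ * Real.exp x := by
  have hexp : ∫ t in (0 : ℝ)..1, x * Real.exp (x * t) = Real.exp x - 1 := by
    rw [intervalIntegral.integral_eq_sub_of_hasDerivAt (f := fun t => Real.exp (x * t))]
    · simp
    · intro t _
      simpa [mul_comm] using ((hasDerivAt_id t).const_mul x).exp
    · exact Continuous.intervalIntegrable (by fun_prop) _ _
  have hpow : ∀ t ∈ Set.Icc (0 : ℝ) 1, x * (t ^ σ * Real.exp (x * t)) ≤
      2 ^ |σ| * (x * Real.exp (x * t)) + t ^ σ * Real.exp x := by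
    rintro t ⟨h0, h1⟩
    have hts := Real.rpow_nonneg h0 σ
    rcases le_total t (1 / 2) with h | h
    · have h2 : x * Real.exp (x * t) ≤ Real.exp x := by
        have h3 : x * Real.exp (x * t) ≤ x * Real.exp (x / 2) := by
          gcongr; nlinarith
        have h4 : x ≤ Real.exp (x / 2) := by
          have := Real.add_one_le_exp (x / 4)
          have h5 : Real.exp (x / 2) = Real.exp (x / 4) ^ 2 := by
            rw [← Real.exp_nat_mul]; congr 1; push_cast; ring
          nlinarith [sq_nonneg (x / 4 - 1)]
        calc _ ≤ x * Real.exp (x / 2) := h3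
          _ ≤ Real.exp (x / 2) * Real.exp (x / 2) := by gcongr
          _ = _ := by rw [← Real.exp_add]; congr 1; ring
      have : 0 ≤ (2 : ℝ) ^ |σ| * (x * Real.exp (x * t)) := by positivity
      nlinarith
    · have h2 : t ^ σ ≤ 2 ^ |σ| := by
        have ht : 0 < t := by linarith
        calc t ^ σ ≤ t ^ (-|σ|) :=
              Real.rpow_le_rpow_of_exponent_ge ht h1 (neg_abs_le σ)
          _ ≤ (1 / 2) ^ (-|σ|) :=
              Real.rpow_le_rpow_of_nonpos (by norm_num) h (by simp)
          _ = _ := by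
              rw [one_div, Real.inv_rpow (by norm_num), Real.rpow_neg (by norm_num), inv_inv]
      have h3 : 0 ≤ x * Real.exp (x * t) := by positivity
      have h4 : 0 ≤ t ^ σ * Real.exp x := by positivity
      nlinarith
  rw [← intervalIntegral.integral_const_mul]
  have hi1 : IntervalIntegrable (fun t : ℝ => 2 ^ |σ| * (x * Real.exp (x * t))) volume 0 1 :=
    Continuous.intervalIntegrable (by fun_prop) _ _
  have hi2 : IntervalIntegrable (fun t : ℝ => t ^ σ * Real.exp x) volume 0 1 :=
    (intervalIntegral.intervalIntegrable_rpow' hσ).mul_const _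
  refine (intervalIntegral.integral_mono_on zero_le_one
    ((intervalIntegrable_rpow_mul_exp hσ x).const_mul x) (hi1.add hi2) hpow).trans ?_
  rw [intervalIntegral.integral_add hi1 hi2, intervalIntegral.integral_const_mul, hexp,
    intervalIntegral.integral_mul_const, integral_rpow_zero_one hσ, gainConst]
  have : (0 : ℝ) < 2 ^ |σ| := by positivity
  nlinarith

/-! ### Weighted bounds and integration along rays from `α` -/

theorem IsStarShapedAround.add_smul_mem {α : ℂ} {Ω : Set ℂ} (h : IsStarShapedAround α Ω) {a : ℂ}
    (ha : a ∈ Ω) {t : ℝ} (h0 : 0 < t) (h1 : t ≤ 1) : α + (t : ℂ) * (a - α) ∈ Ω := by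
  rcases h1.lt_or_eq with h1 | rfl
  · refine h a ha ⟨1 - t, t, by linarith, h0, by ring, ?_⟩
    simp only [real_smul]; push_cast; ring
  · simpa using ha

theorem norm_segment_sub {α a : ℂ} {t : ℝ} (h0 : 0 ≤ t) :
    ‖α + (t : ℂ) * (a - α) - α‖ = t * ‖a - α‖ := by
  rw [add_sub_cancel_left, norm_mul, norm_real, Real.norm_of_nonneg h0]

/-- `f` is holomorphic on `Ω`, with `|f| ≤ C |ζ - α|^σ e^{Λ|ζ - α|}`. -/
structure HasExpBound (α : ℂ) (Ω : Set ℂ) (σ Λ C : ℝ) (f : ℂ → ℂ) : Prop where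
  differentiableOn : DifferentiableOn ℂ f Ω
  norm_le : ∀ ζ ∈ Ω, ‖f ζ‖ ≤ C * (‖ζ - α‖ ^ σ * Real.exp (Λ * ‖ζ - α‖))

variable {α : ℂ} {Ω : Set ℂ} {σ Λ C : ℝ} {f g : ℂ → ℂ}

theorem mem_expSpace_iff : f ∈ expSpace α Ω σ ↔ ∃ Λ C, HasExpBound α Ω σ Λ C f := by
  simp only [expSpace, expSpaceOfType, Set.mem_iUnion, Set.mem_ofPred_eq]
  exact ⟨fun ⟨Λ, h, C, h'⟩ => ⟨Λ, C, h, h'⟩, fun ⟨Λ, C, h, h'⟩ => ⟨Λ, h, C, h'⟩⟩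

theorem norm_sub_pos (hα : α ∉ Ω) {ζ : ℂ} (hζ : ζ ∈ Ω) : 0 < ‖ζ - α‖ :=
  norm_pos_iff.2 (sub_ne_zero.2 fun h => hα (h ▸ hζ))

namespace HasExpBound

theorem mono (h : HasExpBound α Ω σ Λ C f) {Λ' C' : ℝ} (hC : 0 ≤ C') (hΛ : Λ ≤ Λ') (hC' : C ≤ C') :
    HasExpBound α Ω σ Λ' C' f :=
  ⟨h.1, fun ζ hζ => (h.2 ζ hζ).trans (by gcongr)⟩

theorem nonneg (h : HasExpBound α Ω σ Λ C f) (hα : α ∉ Ω) (hne : Ω.Nonempty) : 0 ≤ C := by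
  obtain ⟨ζ, hζ⟩ := hne
  have := norm_sub_pos hα hζ
  exact nonneg_of_mul_nonneg_left ((norm_nonneg _).trans (h.2 ζ hζ)) (by positivity)

theorem add_const_mul (hf : HasExpBound α Ω σ Λ C f) {C' : ℝ} (hg : HasExpBound α Ω σ Λ C' g)
    (c : ℂ) : HasExpBound α Ω σ Λ (C + ‖c‖ * C') (fun ζ => f ζ + c * g ζ) := by
  refine ⟨hf.1.add (hg.1.const_mul c), fun ζ hζ => (norm_add_le _ _).trans ?_⟩
  rw [norm_mul, add_mul, mul_assoc]
  exact add_le_add (hf.2 ζ hζ) (mul_le_mul_of_nonneg_left (hg.2 ζ hζ) (norm_nonneg _))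

theorem congr (hf : HasExpBound α Ω σ Λ C f) (h : Set.EqOn g f Ω) : HasExpBound α Ω σ Λ C g :=
  ⟨hf.1.congr h, fun ζ hζ => by rw [h hζ]; exact hf.2 ζ hζ⟩

/-- Trading powers of `|ζ - α|` for exponential growth. -/
theorem of_exponent_add (hf : HasExpBound α Ω (σ + 1) Λ C f) (hC : 0 ≤ C) (hα : α ∉ Ω) :
    HasExpBound α Ω σ (Λ + 1) C f := by
  refine ⟨hf.1, fun ζ hζ => (hf.2 ζ hζ).trans ?_⟩
  have := norm_sub_pos hα hζ
  have h2 := Real.add_one_le_exp ‖ζ - α‖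
  rw [Real.rpow_add this, Real.rpow_one, add_mul, Real.exp_add, one_mul]
  have : 0 < ‖ζ - α‖ ^ σ := by positivity
  gcongr C * ?_
  calc _ = ‖ζ - α‖ ^ σ * (Real.exp (Λ * ‖ζ - α‖) * ‖ζ - α‖) := by ring
    _ ≤ _ := by gcongr; linarith

theorem norm_segment_le (hf : HasExpBound α Ω σ Λ C f) (hstar : IsStarShapedAround α Ω)
    {a : ℂ} (ha : a ∈ Ω) {t : ℝ} (ht : t ∈ Set.Ioc (0 : ℝ) 1) :
    ‖f (α + (t : ℂ) * (a - α))‖ ≤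
      C * ‖a - α‖ ^ σ * (t ^ σ * Real.exp (Λ * ‖a - α‖ * t)) := by
  refine (hf.2 _ (hstar.add_smul_mem ha ht.1 ht.2)).trans (le_of_eq ?_)
  rw [norm_segment_sub ht.1.le, Real.mul_rpow ht.1.le (norm_nonneg _)]
  ring_nf

end HasExpBound

theorem continuousOn_segment (hf : ContinuousOn f Ω) (hstar : IsStarShapedAround α Ω)
    {a : ℂ} (ha : a ∈ Ω) :
    ContinuousOn (fun t : ℝ => f (α + (t : ℂ) * (a - α))) (Set.Ioc 0 1) :=
  hf.comp (by fun_prop) fun _ ht => hstar.add_smul_mem ha ht.1 ht.2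

theorem aestronglyMeasurable_segment (hf : ContinuousOn f Ω) (hstar : IsStarShapedAround α Ω)
    {a : ℂ} (ha : a ∈ Ω) :
    AEStronglyMeasurable (fun t : ℝ => f (α + (t : ℂ) * (a - α)))
      (volume.restrict (Set.uIoc (0 : ℝ) 1)) := by
  rw [Set.uIoc_of_le zero_le_one]
  exact (continuousOn_segment hf hstar ha).aestronglyMeasurable measurableSet_Ioc

theorem HasExpBound.baseIntegrable (hf : HasExpBound α Ω σ Λ C f) (hσ : -1 < σ)
    (hstar : IsStarShapedAround α Ω) {a : ℂ} (ha : a ∈ Ω) : BaseIntegrable α f a := by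
  refine ((intervalIntegrable_rpow_mul_exp hσ (Λ * ‖a - α‖)).const_mul
    (C * ‖a - α‖ ^ σ)).mono_fun' (aestronglyMeasurable_segment hf.1.continuousOn hstar ha) ?_
  rw [Set.uIoc_of_le zero_le_one]
  exact (ae_restrict_iff' measurableSet_Ioc).2 (.of_forall fun t ht =>
    hf.norm_segment_le hstar ha ht)

/-- The size of the integral of a function that is bounded along a segment. -/
theorem norm_baseIntegral_le_of_segment {a : ℂ} {x B : ℝ} (hσ : -1 < σ)
    (h : ∀ t ∈ Set.Ioc (0 : ℝ) 1,
      ‖f (α + (t : ℂ) * (a - α))‖ ≤ B * (t ^ σ * Real.exp (x * t))) :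
    ‖baseIntegral α f a‖ ≤
      B * ‖a - α‖ * ∫ t in (0 : ℝ)..1, t ^ σ * Real.exp (x * t) := by
  rw [baseIntegral, intervalIntegral.integral_mul_const, norm_mul]
  have : ‖∫ t in (0 : ℝ)..1, f (α + (t : ℂ) * (a - α))‖ ≤
      ∫ t in (0 : ℝ)..1, B * (t ^ σ * Real.exp (x * t)) :=
    intervalIntegral.norm_integral_le_of_norm_le zero_le_one
      (.of_forall h) ((intervalIntegrable_rpow_mul_exp hσ x).const_mul B)
  rw [intervalIntegral.integral_const_mul] at this
  calc _ ≤ (B * ∫ t in (0 : ℝ)..1, t ^ σ * Real.exp (x * t)) * ‖a - α‖ := by gcongr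
    _ = _ := by ring

/-- Differentiation under the integral sign. The integrand may be singular at `t = 0`, but it is
dominated by a multiple of `t^σ`, uniformly for endpoints near `a`. -/
theorem differentiableOn_baseIntegral (hf : HasExpBound α Ω σ Λ C f) (hσ : -1 < σ)
    (hstar : IsStarShapedAround α Ω) (hΩ : IsOpen Ω) (hα : α ∉ Ω) :
    DifferentiableOn ℂ (baseIntegral α f) Ω := by
  intro a ha
  refine DifferentiableAt.differentiableWithinAt ?_
  obtain ⟨ε, hε, hball⟩ := Metric.isOpen_iff.1 hΩ a ha
  have hd : ∀ t ∈ Set.Ioc (0 : ℝ) 1, ∀ z ∈ Ω, HasDerivAt (fun z => f (α + (t : ℂ) * (z - α)))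
      (deriv f (α + (t : ℂ) * (z - α)) * t) z := by
    intro t ht z hz
    have h1 := (hf.1.differentiableAt (hΩ.mem_nhds (hstar.add_smul_mem hz ht.1 ht.2))).hasDerivAt
    have h2 : HasDerivAt (fun z : ℂ => α + (t : ℂ) * (z - α)) t z := by
      simpa using (((hasDerivAt_id z).sub_const α).const_mul (t : ℂ)).const_add α
    exact h1.comp z h2
  -- a bound for the weight near `a`
  obtain ⟨K, hK⟩ : ∃ K, ∀ z ∈ Metric.closedBall a (ε / 2),
      ‖C * ‖z - α‖ ^ σ * Real.exp (|Λ| * ‖z - α‖)‖ ≤ K := by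
    refine (isCompact_closedBall a (ε / 2)).exists_bound_of_continuousOn ?_
    have hne : ∀ z ∈ Metric.closedBall a (ε / 2), ‖z - α‖ ≠ 0 := fun z hz =>
      (norm_sub_pos hα (hball (Metric.closedBall_subset_ball (by linarith) hz))).ne'
    exact (continuousOn_const.mul (ContinuousOn.rpow_const (by fun_prop)
      fun z hz => Or.inl (hne z hz))).mul (by fun_prop)
  have hfK : ∀ t ∈ Set.Ioc (0 : ℝ) 1, ∀ z ∈ Metric.closedBall a (ε / 2),
      ‖f (α + (t : ℂ) * (z - α))‖ ≤ K * t ^ σ := by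
    intro t ht z hz
    have hzΩ := hball (Metric.closedBall_subset_ball (by linarith) hz)
    refine (hf.norm_segment_le hstar hzΩ ht).trans ?_
    have ht0 := ht.1
    have hr := norm_sub_pos hα hzΩ
    have hC := hf.nonneg hα ⟨a, ha⟩
    refine le_trans ?_ (mul_le_mul_of_nonneg_right ((le_abs_self _).trans (hK z hz))
      (Real.rpow_nonneg ht0.le σ))
    -- `Λ` may be negative; passing to `|Λ|` allows the factor `t ≤ 1` in the exponent to be
    -- dropped.
    calc _ ≤ C * ‖z - α‖ ^ σ * (t ^ σ * Real.exp (|Λ| * ‖z - α‖)) := by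
          gcongr C * ‖z - α‖ ^ σ * (t ^ σ * Real.exp ?_)
          calc _ ≤ |Λ| * ‖z - α‖ * t := by gcongr; exact le_abs_self _
            _ ≤ |Λ| * ‖z - α‖ * 1 := by gcongr; exact ht.2
            _ = _ := mul_one _
      _ = _ := by ring
  -- The derivative in the endpoint is dominated by Cauchy's estimate on discs of radius `ε / 4`:
  -- for centres within `ε / 4` of `a` these stay in the closed ball of radius `ε / 2`, where `hfK`
  -- applies.
  have hmain := (intervalIntegral.hasDerivAt_integral_of_dominated_loc_of_deriv_le
    (μ := volume) (a := 0) (b := 1) (x₀ := a) (s := Metric.ball a (ε / 4))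
    (F := fun z t => f (α + ((t : ℝ) : ℂ) * (z - α)))
    (F' := fun z t => deriv f (α + ((t : ℝ) : ℂ) * (z - α)) * t)
    (bound := fun t => K * t ^ σ / (ε / 4))
    (Metric.ball_mem_nhds a (by positivity))
    (by
      filter_upwards [hΩ.mem_nhds ha] with z hz
      exact aestronglyMeasurable_segment hf.1.continuousOn hstar hz)
    (hf.baseIntegrable hσ hstar ha)
    ((aestronglyMeasurable_segment (hf.1.deriv hΩ).continuousOn hstar ha).mul
      (by fun_prop))
    (.of_forall fun t ht z hz => by
      rw [Set.uIoc_of_le zero_le_one] at ht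
      have hz' : ∀ w ∈ Metric.closedBall z (ε / 4), w ∈ Metric.closedBall a (ε / 2) := by
        intro w hw
        have h1 := Metric.mem_closedBall.1 hw
        have h2 := Metric.mem_ball.1 hz
        exact Metric.mem_closedBall.2 ((dist_triangle w z a).trans (by linarith))
      have hΩ' : ∀ w ∈ Metric.closedBall z (ε / 4), w ∈ Ω := fun w hw =>
        hball (Metric.closedBall_subset_ball (by linarith) (hz' w hw))
      have hzz := Metric.mem_closedBall_self (x := z) (show 0 ≤ ε / 4 by positivity)
      rw [← (hd t ht z (hΩ' z hzz)).deriv]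
      refine Complex.norm_deriv_le_of_forall_mem_sphere_norm_le (by positivity) ?_ fun w hw =>
        hfK t ht w (hz' w (Metric.sphere_subset_closedBall hw))
      refine DifferentiableOn.diffContOnCl fun w hw => ?_
      rw [closure_ball _ (by positivity)] at hw
      exact (hd t ht w (hΩ' w hw)).differentiableAt.differentiableWithinAt)
    (((intervalIntegral.intervalIntegrable_rpow' hσ).const_mul K).div_const _)
    (.of_forall fun t ht z hz => by
      rw [Set.uIoc_of_le zero_le_one] at ht
      exact hd t ht z (hball (Metric.ball_subset_ball (by linarith) hz)))).2
  have heq : baseIntegral α f = fun a =>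
      (∫ t in (0 : ℝ)..1, f (α + (t : ℂ) * (a - α))) * (a - α) := by
    funext a; rw [baseIntegral, intervalIntegral.integral_mul_const]
  rw [heq]
  exact hmain.differentiableAt.mul (by fun_prop)

/-- Integration raises the exponent by one. -/
theorem HasExpBound.baseIntegral_succ (hf : HasExpBound α Ω σ Λ C f) (hσ : -1 < σ) (hΛ : 0 ≤ Λ)
    (hstar : IsStarShapedAround α Ω) (hΩ : IsOpen Ω) (hα : α ∉ Ω) :
    HasExpBound α Ω (σ + 1) Λ (C / (σ + 1)) (baseIntegral α f) := by
  refine ⟨differentiableOn_baseIntegral hf hσ hstar hΩ hα, fun a ha => ?_⟩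
  have hr := norm_sub_pos hα ha
  have hC := hf.nonneg hα ⟨a, ha⟩
  calc _ ≤ C * ‖a - α‖ ^ σ * ‖a - α‖ *
        ∫ t in (0 : ℝ)..1, t ^ σ * Real.exp (Λ * ‖a - α‖ * t) :=
        norm_baseIntegral_le_of_segment hσ fun t ht => hf.norm_segment_le hstar ha ht
    _ ≤ C * ‖a - α‖ ^ σ * ‖a - α‖ * (Real.exp (Λ * ‖a - α‖) / (σ + 1)) := by
        gcongr
        exact integral_rpow_mul_exp_le hσ (by positivity)
    _ = _ := by rw [Real.rpow_add hr, Real.rpow_one]; ring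

/-- Integration is small for fast exponential weights. -/
theorem HasExpBound.baseIntegral (hf : HasExpBound α Ω σ Λ C f) (hσ : -1 < σ) (hΛ : 0 < Λ)
    (hstar : IsStarShapedAround α Ω) (hΩ : IsOpen Ω) (hα : α ∉ Ω) :
    HasExpBound α Ω σ Λ (C * (gainConst σ / Λ)) (baseIntegral α f) := by
  refine ⟨differentiableOn_baseIntegral hf hσ hstar hΩ hα, fun a ha => ?_⟩
  have hr := norm_sub_pos hα ha
  have hC := hf.nonneg hα ⟨a, ha⟩
  calc _ ≤ C * ‖a - α‖ ^ σ * ‖a - α‖ *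
        ∫ t in (0 : ℝ)..1, t ^ σ * Real.exp (Λ * ‖a - α‖ * t) :=
        norm_baseIntegral_le_of_segment hσ fun t ht => hf.norm_segment_le hstar ha ht
    _ = C * ‖a - α‖ ^ σ / Λ * (Λ * ‖a - α‖ *
          ∫ t in (0 : ℝ)..1, t ^ σ * Real.exp (Λ * ‖a - α‖ * t)) := by field_simp
    _ ≤ C * ‖a - α‖ ^ σ / Λ * (gainConst σ * Real.exp (Λ * ‖a - α‖)) := by
        gcongr ?_ * ?_
        exact mul_integral_rpow_mul_exp_le hσ (by positivity)
    _ = _ := by ring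

theorem HasExpBound.iterate_baseIntegral (hf : HasExpBound α Ω σ Λ C f) (hσ : -1 < σ)
    (hΛ : 0 < Λ) (hstar : IsStarShapedAround α Ω) (hΩ : IsOpen Ω) (hα : α ∉ Ω) (j : ℕ) :
    HasExpBound α Ω σ Λ (C * (gainConst σ / Λ) ^ j) ((LevelOne.baseIntegral α)^[j] f) := by
  induction j with
  | zero => simpa using hf
  | succ j ih =>
    rw [Function.iterate_succ_apply', pow_succ, ← mul_assoc]
    exact ih.baseIntegral hσ hΛ hstar hΩ hα

/-- The segment meets the complement of `Ω` at most at `t = 0`, a null set, so values outside `Ω`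
are irrelevant. -/
theorem baseIntegral_congr (hstar : IsStarShapedAround α Ω) (h : Set.EqOn f g Ω) :
    Set.EqOn (baseIntegral α f) (baseIntegral α g) Ω := fun a ha => by
  refine intervalIntegral.integral_congr_ae (.of_forall fun t ht => ?_)
  rw [Set.uIoc_of_le zero_le_one] at ht
  simp only [h (hstar.add_smul_mem ha ht.1 ht.2)]

theorem baseIntegral_add_const_mul {a : ℂ} (hf : BaseIntegrable α f a)
    (hg : BaseIntegrable α g a) (c : ℂ) :
    baseIntegral α (fun ζ => f ζ + c * g ζ) a = baseIntegral α f a + c * baseIntegral α g a := by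
  simp only [baseIntegral, intervalIntegral.integral_mul_const]
  rw [intervalIntegral.integral_add hf (hg.const_mul c), intervalIntegral.integral_const_mul]
  ring

/-! ### Series of weighted functions and the contraction principle -/

theorem HasExpBound.summable {F : ℕ → ℂ → ℂ} {C : ℕ → ℝ}
    (hF : ∀ j, HasExpBound α Ω σ Λ (C j) (F j)) (hC : Summable C) {ζ : ℂ} (hζ : ζ ∈ Ω) :
    Summable fun j => F j ζ :=
  (hC.mul_right _).of_norm_bounded fun j => (hF j).2 ζ hζ

theorem HasExpBound.tsum (hΩ : IsOpen Ω) (hα : α ∉ Ω) {F : ℕ → ℂ → ℂ} {C : ℕ → ℝ}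
    (hF : ∀ j, HasExpBound α Ω σ Λ (C j) (F j)) (hC : Summable C) :
    HasExpBound α Ω σ Λ (∑' j, C j) (fun ζ => ∑' j, F j ζ) := by
  refine ⟨fun a ha => ?_, fun ζ hζ => ?_⟩
  · have hr := norm_sub_pos hα ha
    have hw : ContinuousAt (fun ζ : ℂ => ‖ζ - α‖ ^ σ * Real.exp (Λ * ‖ζ - α‖)) a :=
      (ContinuousAt.rpow_const (f := fun ζ : ℂ => ‖ζ - α‖) (by fun_prop) (Or.inl hr.ne')).mul
        (by fun_prop)
    -- On a neighbourhood of `a` the weight stays below its value at `a` plus one, so the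
    -- Weierstrass M-test applies locally.
    obtain ⟨U, hU, hUo, haU⟩ := eventually_nhds_iff.1
      ((hΩ.eventually_mem ha).and (hw.eventually_lt_const (lt_add_one _)))
    refine ((Complex.differentiableOn_tsum_of_summable_norm
      (hC.mul_right (‖a - α‖ ^ σ * Real.exp (Λ * ‖a - α‖) + 1))
      (fun j => (hF j).1.mono fun z hz => (hU z hz).1) hUo fun j w hw => ?_).differentiableAt
        (hUo.mem_nhds haU)).differentiableWithinAt
    exact ((hF j).2 w (hU w hw).1).trans
      (mul_le_mul_of_nonneg_left (hU w hw).2.le ((hF j).nonneg hα ⟨a, ha⟩))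
  · rw [← tsum_mul_right]
    exact tsum_of_norm_bounded (hC.mul_right _).hasSum fun j => (hF j).2 ζ hζ

/-- The contraction principle for weighted holomorphic functions. -/
theorem exists_eqOn_of_contraction (hΩ : IsOpen Ω) (hα : α ∉ Ω) {T : (ℂ → ℂ) → ℂ → ℂ}
    {κ G : ℝ} (hκ0 : 0 ≤ κ) (hκ : κ < 1)
    (hT : ∀ (f g : ℂ → ℂ) (Cf Cg N : ℝ), HasExpBound α Ω σ Λ Cf f → HasExpBound α Ω σ Λ Cg g →
      HasExpBound α Ω σ Λ N (fun ζ => f ζ - g ζ) →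
      HasExpBound α Ω σ Λ (κ * N) (fun ζ => T f ζ - T g ζ))
    (hG : HasExpBound α Ω σ Λ G (T fun _ => 0)) :
    ∃ f C, HasExpBound α Ω σ Λ C f ∧ Set.EqOn (T f) f Ω := by
  set u : ℕ → ℂ → ℂ := fun n => T^[n] fun _ => 0 with hu
  have hu0 : u 0 = fun _ => 0 := rfl
  have hus : ∀ n, u (n + 1) = T (u n) := fun n => Function.iterate_succ_apply' T n _
  have hstep : ∀ n, (∃ Cn, HasExpBound α Ω σ Λ Cn (u n)) ∧
      HasExpBound α Ω σ Λ (G * κ ^ n) (fun ζ => u (n + 1) ζ - u n ζ) := by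
    intro n
    induction n with
    | zero =>
      refine ⟨⟨0, ⟨by rw [hu0]; exact differentiableOn_const _, fun ζ _ => by simp [hu0]⟩⟩, ?_⟩
      simpa [hus, hu0] using hG
    | succ n ih =>
      obtain ⟨⟨Cn, hCn⟩, hd⟩ := ih
      have h1 : HasExpBound α Ω σ Λ (Cn + ‖(1 : ℂ)‖ * (G * κ ^ n)) (u (n + 1)) :=
        (hCn.add_const_mul hd 1).congr fun ζ _ => by ring
      refine ⟨⟨_, h1⟩, ?_⟩
      rw [hus (n + 1), hus n, pow_succ, ← mul_assoc, mul_comm]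
      rw [hus n] at h1 hd
      exact hT _ _ _ _ _ h1 hCn hd
  -- The limit is the sum of the telescoping series of increments; as `u 0 = 0`, its partial sums
  -- are the iterates.
  have hsum : Summable fun n => G * κ ^ n := (summable_geometric_of_lt_one hκ0 hκ).mul_left G
  set f : ℂ → ℂ := fun ζ => ∑' n, (u (n + 1) ζ - u n ζ) with hf
  have hfb := HasExpBound.tsum hΩ hα (fun n => (hstep n).2) hsum
  have htail : ∀ n, HasExpBound α Ω σ Λ (∑' k, G * κ ^ (k + n)) (fun ζ => f ζ - u n ζ) := by
    intro n
    refine (HasExpBound.tsum hΩ hα (fun k => (hstep (k + n)).2)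
      ((summable_nat_add_iff n).2 hsum)).congr fun ζ hζ => ?_
    have hs := HasExpBound.summable (fun n => (hstep n).2) hsum hζ
    have h1 := hs.sum_add_tsum_nat_add n
    rw [Finset.sum_range_sub (fun n => u n ζ)] at h1
    simp only [hf, ← h1, hu0]
    ring
  refine ⟨f, _, hfb, fun ζ hζ => ?_⟩
  have hlim : Filter.Tendsto (fun n : ℕ => ∑' k, G * κ ^ (k + n)) Filter.atTop (nhds 0) :=
    tendsto_sum_nat_add fun n => G * κ ^ n
  set w := ‖ζ - α‖ ^ σ * Real.exp (Λ * ‖ζ - α‖)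
  have hbound : ∀ n, ‖T f ζ - f ζ‖ ≤
      κ * (∑' k, G * κ ^ (k + n)) * w + (∑' k, G * κ ^ (k + (n + 1))) * w := by
    intro n
    obtain ⟨Cn, hCn⟩ := (hstep n).1
    have h1 := (hT _ _ _ _ _ hfb hCn (htail n)).2 ζ hζ
    have h2 := (htail (n + 1)).2 ζ hζ
    calc ‖T f ζ - f ζ‖ = ‖(T f ζ - T (u n) ζ) - (f ζ - u (n + 1) ζ)‖ := by
          rw [hus]; congr 1; ring
      _ ≤ _ := (norm_sub_le _ _).trans (add_le_add h1 h2)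
  have hlim2 : Filter.Tendsto (fun n : ℕ => κ * (∑' k, G * κ ^ (k + n)) * w +
      (∑' k, G * κ ^ (k + (n + 1))) * w) Filter.atTop (nhds 0) := by
    simpa using ((hlim.const_mul κ).mul_const w).add
      (((Filter.tendsto_add_atTop_iff_nat 1).2 hlim).mul_const w)
  exact sub_eq_zero.1 (norm_le_zero_iff.1 (ge_of_tendsto' hlim2 hbound))

/-! ### The power series in the integration operator -/

variable {R : ℂ → ℂ}

/-- `R` is holomorphic on `|w| < 1/(A+1)`, and its Taylor series converges absolutely at half that
radius. Using `A + 1` covers the case `A = 0`. -/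
theorem exists_summable_norm_coeffAt {A : ℝ} (hA : 0 ≤ A)
    (hR : DifferentiableOn ℂ R {w : ℂ | A * ‖w‖ < 1}) :
    ∃ q : ℝ, 0 < q ∧ Summable fun j => ‖coeffAt R j‖ * q ^ j := by
  have hr : 0 < 1 / (A + 1) := by positivity
  refine ⟨1 / (A + 1) / 2, by positivity, ?_⟩
  have hsub : Metric.ball (0 : ℂ) (1 / (A + 1)) ⊆ {w : ℂ | A * ‖w‖ < 1} := by
    intro w hw
    rw [mem_ball_zero_iff, lt_div_iff₀ (by positivity)] at hw
    have := norm_nonneg w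
    show A * ‖w‖ < 1
    nlinarith
  have hz : ((1 / (A + 1) / 2 : ℝ) : ℂ) ∈ Metric.ball (0 : ℂ) (1 / (A + 1)) := by
    rw [mem_ball_zero_iff, norm_real, Real.norm_of_nonneg (by positivity)]
    linarith
  refine (hasSum_taylorSeries_on_ball (hR.mono hsub) hz).summable.norm.congr fun j => ?_
  simp only [coeffAt, sub_zero, smul_eq_mul, norm_mul, norm_inv, norm_div, norm_pow, norm_real,
    Real.norm_of_nonneg (show 0 ≤ 1 / (A + 1) / 2 by positivity)]
  ring

section Series

variable {q : ℝ} (hq : 0 < q) (hsum : Summable fun j => ‖coeffAt R j‖ * q ^ j)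
  (hσ : -1 < σ) (hΛ : gainConst σ / q ≤ Λ)
  (hstar : IsStarShapedAround α Ω) (hΩ : IsOpen Ω) (hα : α ∉ Ω)

include hq hσ hΛ hstar hΩ hα in
-- The condition `gainConst σ / q ≤ Λ` says that integration has norm at most `q` for the weight, so
-- the `j`-th term is controlled by the summable `|R_j| q^j`.
theorem HasExpBound.series_term (hf : HasExpBound α Ω σ Λ C f) (j : ℕ) :
    HasExpBound α Ω σ Λ (C * (‖coeffAt R j‖ * q ^ j))
      (fun ζ => coeffAt R j * ((LevelOne.baseIntegral α)^[j] f) ζ) := by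
  have hc := gainConst_pos hσ
  have hΛ0 : 0 < Λ := lt_of_lt_of_le (by positivity) hΛ
  have h := hf.iterate_baseIntegral hσ hΛ0 hstar hΩ hα j
  refine ⟨h.1.const_mul _, fun ζ hζ => ?_⟩
  have hC := hf.nonneg hα ⟨ζ, hζ⟩
  have hle : gainConst σ / Λ ≤ q := by
    rw [div_le_iff₀ hΛ0]; rw [div_le_iff₀ hq] at hΛ; linarith
  rw [norm_mul]
  calc _ ≤ ‖coeffAt R j‖ * (C * (gainConst σ / Λ) ^ j *
          (‖ζ - α‖ ^ σ * Real.exp (Λ * ‖ζ - α‖))) := by gcongr; exact h.2 ζ hζ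
    _ ≤ ‖coeffAt R j‖ * (C * q ^ j * (‖ζ - α‖ ^ σ * Real.exp (Λ * ‖ζ - α‖))) := by gcongr
    _ = _ := by ring

include hq hsum hσ hΛ hstar hΩ hα

theorem HasExpBound.summable_series (hf : HasExpBound α Ω σ Λ C f) {a : ℂ} (ha : a ∈ Ω) :
    Summable fun j : ℕ => coeffAt R j * ((LevelOne.baseIntegral α)^[j] f) a :=
  HasExpBound.summable (fun j => hf.series_term hq hσ hΛ hstar hΩ hα j) (hsum.mul_left C) ha

theorem HasExpBound.seriesOp (hf : HasExpBound α Ω σ Λ C f) :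
    HasExpBound α Ω σ Λ (C * ∑' j, ‖coeffAt R j‖ * q ^ j) (LevelOne.seriesOp R α f) := by
  rw [← tsum_mul_left]
  exact HasExpBound.tsum hΩ hα (fun j => hf.series_term hq hσ hΛ hstar hΩ hα j)
    (hsum.mul_left C)

omit hsum in
theorem iterate_baseIntegral_add_const_mul (hf : HasExpBound α Ω σ Λ C f) {C' : ℝ}
    (hg : HasExpBound α Ω σ Λ C' g) (c : ℂ) (j : ℕ) :
    Set.EqOn ((baseIntegral α)^[j] fun ζ => f ζ + c * g ζ)
      (fun ζ => ((baseIntegral α)^[j] f) ζ + c * ((baseIntegral α)^[j] g) ζ) Ω := by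
  have hΛ0 : 0 < Λ := lt_of_lt_of_le (div_pos (gainConst_pos hσ) hq) hΛ
  induction j with
  | zero => exact fun _ _ => rfl
  | succ j ih =>
    simp only [Function.iterate_succ_apply']
    exact fun a ha => (baseIntegral_congr hstar ih ha).trans (baseIntegral_add_const_mul
      ((hf.iterate_baseIntegral hσ hΛ0 hstar hΩ hα j).baseIntegrable hσ hstar ha)
      ((hg.iterate_baseIntegral hσ hΛ0 hstar hΩ hα j).baseIntegrable hσ hstar ha) c)

theorem seriesOp_add_const_mul (hf : HasExpBound α Ω σ Λ C f) {C' : ℝ}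
    (hg : HasExpBound α Ω σ Λ C' g) (c : ℂ) :
    Set.EqOn (seriesOp R α fun ζ => f ζ + c * g ζ)
      (fun ζ => seriesOp R α f ζ + c * seriesOp R α g ζ) Ω := by
  intro a ha
  have h1 := hf.summable_series hq hsum hσ hΛ hstar hΩ hα ha
  have h2 := hg.summable_series hq hsum hσ hΛ hstar hΩ hα ha
  simp only [seriesOp]
  rw [← tsum_mul_left, ← h1.tsum_add (h2.mul_left c)]
  refine tsum_congr fun j => ?_
  rw [iterate_baseIntegral_add_const_mul hq hσ hΛ hstar hΩ hα hf hg c j ha]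
  ring

end Series

/-! ### Polynomial estimates -/

theorem exists_norm_eval_neg_le (p : ℂ[X]) (α : ℂ) :
    ∃ B : ℝ, 0 ≤ B ∧ ∀ ζ, ‖p.eval (-ζ)‖ ≤ B * (1 + ‖ζ - α‖) ^ p.natDegree := by
  refine ⟨∑ i ∈ Finset.range (p.natDegree + 1), ‖p.coeff i‖ * (1 + ‖α‖) ^ p.natDegree,
    by positivity, fun ζ => ?_⟩
  rw [eval_eq_sum_range, Finset.sum_mul]
  refine (norm_sum_le _ _).trans (Finset.sum_le_sum fun i hi => ?_)
  rw [norm_mul, norm_pow, norm_neg, mul_assoc, ← mul_pow]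
  have h1 : ‖ζ‖ ≤ ‖ζ - α‖ + ‖α‖ := by simpa using norm_add_le (ζ - α) α
  have h2 := norm_nonneg α
  have h3 := norm_nonneg (ζ - α)
  have h4 : (1 : ℝ) ≤ (1 + ‖α‖) * (1 + ‖ζ - α‖) := by nlinarith [mul_nonneg h2 h3]
  gcongr
  calc ‖ζ‖ ^ i ≤ ((1 + ‖α‖) * (1 + ‖ζ - α‖)) ^ i := by
        gcongr; nlinarith [mul_nonneg h2 h3]
    _ ≤ _ := pow_le_pow_right₀ h4 (Nat.lt_succ_iff.1 (Finset.mem_range.1 hi))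

theorem one_add_pow_le_exp {r : ℝ} (hr : 0 ≤ r) (n : ℕ) : (1 + r) ^ n ≤ Real.exp (n * r) := by
  rw [Real.exp_nat_mul]
  gcongr
  linarith [Real.add_one_le_exp r]

theorem HasExpBound.mul_eval_neg (p : ℂ[X]) {B : ℝ}
    (hB : ∀ ζ, ‖p.eval (-ζ)‖ ≤ B * (1 + ‖ζ - α‖) ^ p.natDegree) (hB0 : 0 ≤ B)
    (hf : HasExpBound α Ω σ Λ C f) :
    HasExpBound α Ω σ (Λ + p.natDegree) (B * C) (fun ζ => p.eval (-ζ) * f ζ) := by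
  have hd : Differentiable ℂ fun ζ : ℂ => p.eval (-ζ) := p.differentiable.comp differentiable_neg
  refine ⟨hd.differentiableOn.mul hf.1, fun ζ hζ => ?_⟩
  rw [norm_mul, add_mul, Real.exp_add]
  calc _ ≤ (B * Real.exp (p.natDegree * ‖ζ - α‖)) *
        (C * (‖ζ - α‖ ^ σ * Real.exp (Λ * ‖ζ - α‖))) :=
        mul_le_mul ((hB ζ).trans (by gcongr; exact one_add_pow_le_exp (norm_nonneg _) _))
          (hf.2 ζ hζ) (norm_nonneg _) (by positivity)
    _ = _ := by ring

/-- Each factor is bounded away from zero on `F` and grows linearly, hence dominates a multiple of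
`1 + |ζ - α|`. -/
theorem exists_mul_pow_le_norm_prod {F : Set ℂ} (hF : IsClosed F) (α : ℂ) (m : Multiset ℂ)
    (hm : ∀ β ∈ m, -β ∉ F) : ∃ c : ℝ, 0 < c ∧ ∀ ζ ∈ F,
      c * (1 + ‖ζ - α‖) ^ m.card ≤ ‖(m.map fun β => -ζ - β).prod‖ := by
  induction m using Multiset.induction_on with
  | empty => exact ⟨1, one_pos, by simp⟩
  | cons β m ih =>
    obtain ⟨c, hc, h⟩ := ih fun b hb => hm b (Multiset.mem_cons_of_mem hb)
    obtain ⟨δ, hδ, hball⟩ := Metric.isOpen_iff.1 hF.isOpen_compl (-β) (hm β (by simp))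
    have hK : 0 < 1 + (1 + ‖α + β‖) / δ := by positivity
    refine ⟨c / (1 + (1 + ‖α + β‖) / δ), by positivity, fun ζ hζ => ?_⟩
    have h1 : δ ≤ ‖-ζ - β‖ := by
      by_contra! hlt
      refine hball (a := ζ) ?_ hζ
      rw [Metric.mem_ball, dist_eq_norm, ← norm_neg]
      rwa [show -(ζ - -β) = -ζ - β by ring]
    have h2 : 1 + ‖ζ - α‖ ≤ ‖-ζ - β‖ * (1 + (1 + ‖α + β‖) / δ) := by
      have h3 : ‖ζ - α‖ ≤ ‖-ζ - β‖ + ‖α + β‖ := by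
        rw [show ζ - α = -((-ζ - β) + (α + β)) by ring, norm_neg]
        exact norm_add_le _ _
      have h4 : 1 + ‖α + β‖ ≤ ‖-ζ - β‖ * ((1 + ‖α + β‖) / δ) := by
        rw [mul_div_assoc', le_div_iff₀ hδ, mul_comm]
        gcongr
      linarith
    rw [Multiset.map_cons, Multiset.prod_cons, norm_mul, Multiset.card_cons, pow_succ]
    calc _ = (c * (1 + ‖ζ - α‖) ^ m.card) * ((1 + ‖ζ - α‖) / (1 + (1 + ‖α + β‖) / δ)) := by ring
      _ ≤ ‖(m.map fun β => -ζ - β).prod‖ * ‖-ζ - β‖ := by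
        gcongr
        · exact h ζ hζ
        · rwa [div_le_iff₀ hK]
      _ = _ := mul_comm _ _

/-- The simple root `-α` supplies exactly one factor `|ζ - α|`; the other roots stay away from the
closure of `Ω`. The remaining power `n` matches the growth of `Q`, so `Q/P` is `O(1/|ζ - α|)` on all
of `Ω`. -/
theorem exists_mul_pow_le_norm_eval_neg {P : ℂ[X]} (hP : P.Monic) {n : ℕ}
    (hdeg : n + 1 = P.natDegree) (hα : P.IsRoot (-α)) (hsimple : P.rootMultiplicity (-α) = 1)
    (hother : ∀ β : ℂ, P.IsRoot (-β) → β ≠ α → β ∉ closure Ω) :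
    ∃ c : ℝ, 0 < c ∧ ∀ ζ ∈ Ω, c * ‖ζ - α‖ * (1 + ‖ζ - α‖) ^ n ≤ ‖P.eval (-ζ)‖ := by
  have hmem : -α ∈ P.roots := (mem_roots hP.ne_zero).2 hα
  have hroots := Multiset.cons_erase hmem
  have hsplit := IsAlgClosed.splits P
  obtain ⟨c, hc, h⟩ := exists_mul_pow_le_norm_prod (isClosed_closure (s := Ω)) α
    (P.roots.erase (-α)) (fun β hβ => by
      have hβ' := (mem_roots hP.ne_zero).1 (Multiset.mem_of_mem_erase hβ)
      refine hother (-β) (by simpa using hβ') fun hβα => ?_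
      have h1 : Multiset.count (-α) (P.roots.erase (-α)) = 0 := by
        rw [Multiset.count_erase_self, count_roots, hsimple]
      have h2 : β = -α := by rw [← hβα, neg_neg]
      exact Multiset.count_eq_zero.1 h1 (by rwa [h2] at hβ))
  have hcard : (P.roots.erase (-α)).card = n := by
    have h1 := hsplit.natDegree_eq_card_roots
    rw [← hroots, Multiset.card_cons] at h1
    omega
  refine ⟨c, hc, fun ζ hζ => ?_⟩
  have heval : P.eval (-ζ) = (P.roots.map fun β => -ζ - β).prod := by
    conv_lhs => rw [hsplit.eq_prod_roots_of_monic hP]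
    rw [eval_multiset_prod, Multiset.map_map]
    simp
  rw [heval, ← hroots, Multiset.map_cons, Multiset.prod_cons, norm_mul]
  have h1 : ‖-ζ - -α‖ = ‖ζ - α‖ := by rw [← norm_neg]; congr 1; ring
  have h2 := h ζ (subset_closure hζ)
  rw [hcard] at h2
  rw [h1, show c * ‖ζ - α‖ * (1 + ‖ζ - α‖) ^ n = ‖ζ - α‖ * (c * (1 + ‖ζ - α‖) ^ n) by ring]
  gcongr

/-- As `a → α` the quotient of the two sides without the constant tends to `|Q(-α)/P'(-α)| = τ`. The
slack `1/2` keeps the constant below `τ + 1`, as the contraction requires. -/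
theorem exists_pos_norm_eval_segment_mul_le {P Q : ℂ[X]} (hα : P.IsRoot (-α)) {τ : ℝ}
    (hτpos : 0 < τ) (hd : (derivative P).eval (-α) ≠ 0)
    (hτ : Q.eval (-α) = τ * (derivative P).eval (-α)) :
    ∃ ρ : ℝ, 0 < ρ ∧ ∀ a : ℂ, ‖a - α‖ < ρ → ∀ t ∈ Set.Icc (0 : ℝ) 1,
      ‖Q.eval (-(α + (t : ℂ) * (a - α)))‖ * ‖a - α‖ ≤ (τ + 1 / 2) * ‖P.eval (-a)‖ := by
  set p := ‖(derivative P).eval (-α)‖ with hp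
  have hppos : 0 < p := norm_pos_iff.2 hd
  -- The solution of `τ p + η = (τ + 1/2)(p - η)`.
  set η := p / (2 * (τ + 3 / 2)) with hη
  have hηpos : 0 < η := by positivity
  have hQ : ∀ᶠ ζ in nhds α, ‖Q.eval (-ζ)‖ < ‖Q.eval (-α)‖ + η := by
    have hc : ContinuousAt (fun ζ : ℂ => ‖Q.eval (-ζ)‖) α :=
      ((Q.continuous.comp continuous_neg).norm).continuousAt
    exact hc.eventually_lt_const (by linarith)
  have hP : ∀ᶠ ζ in nhds α, (p - η) * ‖ζ - α‖ ≤ ‖P.eval (-ζ)‖ := by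
    have hder : HasDerivAt (fun ζ : ℂ => P.eval (-ζ)) ((derivative P).eval (-α) * -1) α :=
      (P.hasDerivAt (-α)).comp α (hasDerivAt_neg α)
    filter_upwards [(hasDerivAt_iff_isLittleO.1 hder).def hηpos] with ζ hζ
    rw [show P.eval (-α) = 0 from hα, sub_zero, smul_eq_mul] at hζ
    have h1 : ‖(ζ - α) * ((derivative P).eval (-α) * -1)‖ = ‖ζ - α‖ * p := by
      rw [norm_mul, norm_mul, norm_neg, norm_one, mul_one]
    have h2 := norm_sub_norm_le ((ζ - α) * ((derivative P).eval (-α) * -1)) (P.eval (-ζ))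
    rw [norm_sub_rev, h1] at h2
    linarith
  obtain ⟨ρ, hρ, hball⟩ := Metric.eventually_nhds_iff.1 (hQ.and hP)
  refine ⟨ρ, hρ, fun a ha t ht => ?_⟩
  have h1 := (hball (y := α + (t : ℂ) * (a - α)) (by
    rw [dist_eq_norm, norm_segment_sub ht.1]
    nlinarith [ht.2, norm_nonneg (a - α)])).1
  have h2 := (hball (y := a) (by rwa [dist_eq_norm])).2
  have h3 : ‖Q.eval (-α)‖ = τ * p := by
    rw [hτ, norm_mul, norm_real, Real.norm_of_nonneg hτpos.le]
  have h4 : τ * p + η = (τ + 1 / 2) * (p - η) := by rw [hη]; field_simp; ring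
  rw [h3, h4] at h1
  calc _ ≤ (τ + 1 / 2) * (p - η) * ‖a - α‖ := by gcongr
    _ ≤ _ := by rw [mul_assoc]; gcongr

variable {P Q : ℂ[X]}

/-! ### The integral part of the position-domain operator -/

/-- The integral part of `positionOp`. -/
noncomputable def volterraOp (Q : ℂ[X]) (R : ℂ → ℂ) (α : ℂ) (φ : ℂ → ℂ) (a : ℂ) : ℂ :=
  baseIntegral α (fun ζ => Q.eval (-ζ) * φ ζ) a
    + baseIntegral α (baseIntegral α (seriesOp R α φ)) a

theorem positionOp_eq (P Q : ℂ[X]) (R : ℂ → ℂ) (α : ℂ) (φ : ℂ → ℂ) (a : ℂ) :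
    positionOp P Q R α φ a = P.eval (-a) * φ a + volterraOp Q R α φ a :=
  add_assoc _ _ _

theorem HasExpBound.exists_mul_eval_neg (p : ℂ[X]) (hf : HasExpBound α Ω σ Λ C f) :
    ∃ Λ' C', HasExpBound α Ω σ Λ' C' (fun ζ => p.eval (-ζ) * f ζ) := by
  obtain ⟨B, hB0, hB⟩ := exists_norm_eval_neg_le p α
  exact ⟨_, _, hf.mul_eval_neg p hB hB0⟩

section Operator

variable {q : ℝ} (hq : 0 < q) (hsum : Summable fun j => ‖coeffAt R j‖ * q ^ j)
  (hσ : -1 < σ)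
  (hstar : IsStarShapedAround α Ω) (hΩ : IsOpen Ω) (hα : α ∉ Ω)

include hq hsum hσ hstar hΩ hα

theorem HasExpBound.positionOpConverges (hf : HasExpBound α Ω σ Λ C f) (Q : ℂ[X]) {a : ℂ}
    (ha : a ∈ Ω) : PositionOpConverges Q R α f a := by
  have hf' := hf.mono (hf.nonneg hα ⟨a, ha⟩) (le_max_left Λ (gainConst σ / q)) le_rfl
  have hΛ := le_max_right Λ (gainConst σ / q)
  have hΛ0 : 0 < max Λ (gainConst σ / q) := lt_of_lt_of_le (div_pos (gainConst_pos hσ) hq) hΛ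
  have hS := hf'.seriesOp hq hsum hσ hΛ hstar hΩ hα
  obtain ⟨_, _, hQ⟩ := hf.exists_mul_eval_neg Q
  exact ⟨hQ.baseIntegrable hσ hstar ha,
    fun j => (hf'.iterate_baseIntegral hσ hΛ0 hstar hΩ hα j).baseIntegrable hσ hstar ha,
    hf'.summable_series hq hsum hσ hΛ hstar hΩ hα ha,
    hS.baseIntegrable hσ hstar ha,
    (hS.baseIntegral hσ hΛ0 hstar hΩ hα).baseIntegrable hσ hstar ha⟩

variable (hΛ : gainConst σ / q ≤ Λ)

include hΛ

theorem HasExpBound.differentiableOn_volterraOp (hf : HasExpBound α Ω σ Λ C f) (Q : ℂ[X]) :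
    DifferentiableOn ℂ (volterraOp Q R α f) Ω := by
  have hΛ0 : 0 < Λ := lt_of_lt_of_le (div_pos (gainConst_pos hσ) hq) hΛ
  obtain ⟨_, _, hQ⟩ := hf.exists_mul_eval_neg Q
  exact (differentiableOn_baseIntegral hQ hσ hstar hΩ hα).add
    (differentiableOn_baseIntegral ((hf.seriesOp hq hsum hσ hΛ hstar hΩ hα).baseIntegral
      hσ hΛ0 hstar hΩ hα) hσ hstar hΩ hα)

theorem volterraOp_add_const_mul (hf : HasExpBound α Ω σ Λ C f) {C' : ℝ}
    (hg : HasExpBound α Ω σ Λ C' g) (c : ℂ) (Q : ℂ[X]) :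
    Set.EqOn (volterraOp Q R α fun ζ => f ζ + c * g ζ)
      (fun ζ => volterraOp Q R α f ζ + c * volterraOp Q R α g ζ) Ω := by
  intro a ha
  have hΛ0 : 0 < Λ := lt_of_lt_of_le (div_pos (gainConst_pos hσ) hq) hΛ
  obtain ⟨_, _, hfQ⟩ := hf.exists_mul_eval_neg Q
  obtain ⟨_, _, hgQ⟩ := hg.exists_mul_eval_neg Q
  have hfS := hf.seriesOp hq hsum hσ hΛ hstar hΩ hα
  have hgS := hg.seriesOp hq hsum hσ hΛ hstar hΩ hα
  have h1 : baseIntegral α (fun ζ => Q.eval (-ζ) * (f ζ + c * g ζ)) a =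
      baseIntegral α (fun ζ => Q.eval (-ζ) * f ζ) a +
        c * baseIntegral α (fun ζ => Q.eval (-ζ) * g ζ) a := by
    rw [← baseIntegral_add_const_mul (hfQ.baseIntegrable hσ hstar ha)
      (hgQ.baseIntegrable hσ hstar ha)]
    congr 1; funext ζ; ring
  have h2 : Set.EqOn (baseIntegral α (seriesOp R α fun ζ => f ζ + c * g ζ))
      (fun ζ => baseIntegral α (seriesOp R α f) ζ + c * baseIntegral α (seriesOp R α g) ζ) Ω :=
    fun ζ hζ => (baseIntegral_congr hstar
      (seriesOp_add_const_mul hq hsum hσ hΛ hstar hΩ hα hf hg c) hζ).trans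
      (baseIntegral_add_const_mul (hfS.baseIntegrable hσ hstar hζ)
        (hgS.baseIntegrable hσ hstar hζ) c)
  have h3 := (baseIntegral_congr hstar h2 ha).trans (baseIntegral_add_const_mul
    ((hfS.baseIntegral hσ hΛ0 hstar hΩ hα).baseIntegrable hσ hstar ha)
    ((hgS.baseIntegral hσ hΛ0 hstar hΩ hα).baseIntegrable hσ hstar ha) c)
  simp only [volterraOp]
  rw [h1, h3]
  ring

end Operator

/-- For fast exponential weights, the integral part of the operator is dominated by the
multiplication part: near `α` because the exponent `τ` beats the singularity of `Q / P`, and away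
from `α` because of the exponential weight. -/
theorem exists_volterraOp_contraction {q : ℝ} (hq : 0 < q)
    (hsum : Summable fun j => ‖coeffAt R j‖ * q ^ j)
    (hstar : IsStarShapedAround α Ω) (hΩ : IsOpen Ω) (hα : α ∉ Ω)
    {τ : ℝ} (hτpos : 0 < τ) {c : ℝ} (hc : 0 < c)
    (hPc : ∀ ζ ∈ Ω, c * ‖ζ - α‖ * (1 + ‖ζ - α‖) ^ Q.natDegree ≤ ‖P.eval (-ζ)‖)
    {ρ : ℝ} (hρ : 0 < ρ) (hnear : ∀ a : ℂ, ‖a - α‖ < ρ → ∀ t ∈ Set.Icc (0 : ℝ) 1,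
      ‖Q.eval (-(α + (t : ℂ) * (a - α)))‖ * ‖a - α‖ ≤ (τ + 1 / 2) * ‖P.eval (-a)‖) :
    ∃ κ Λ₀ : ℝ, 0 ≤ κ ∧ κ < 1 ∧ gainConst τ / q ≤ Λ₀ ∧ ∀ Λ, Λ₀ ≤ Λ → ∀ N f,
      HasExpBound α Ω τ Λ N f → ∀ a ∈ Ω, ‖volterraOp Q R α f a‖ ≤
        ‖P.eval (-a)‖ * (κ * N * (‖a - α‖ ^ τ * Real.exp (Λ * ‖a - α‖))) := by
  have hτ1 : -1 < τ := by linarith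
  obtain ⟨B, hB0, hB⟩ := exists_norm_eval_neg_le Q α
  set M := ∑' j, ‖coeffAt R j‖ * q ^ j with hM
  have hM0 : 0 ≤ M := tsum_nonneg fun j => by positivity
  set K := gainConst τ
  have hK : 0 < K := gainConst_pos hτ1
  have hτ2 : 0 < τ + 1 := by linarith
  -- `Λ₁` makes the `Q` part at distance at least `ρ` no worse than near `α`, with factor `(τ +
  -- 1/2)/(τ + 1)`; `Λ₂` brings the `R` part down to `(1/4)/(τ + 1)`. Their sum is the contraction
  -- factor below.
  set Λ₁ := B * K / (c * ρ) * ((τ + 1) / (τ + 1 / 2)) with hΛ₁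
  set Λ₂ := 4 * M * K / c with hΛ₂
  refine ⟨(τ + 3 / 4) / (τ + 1), max (K / q) (max Λ₁ Λ₂), by positivity, ?_, le_max_left _ _, ?_⟩
  · rw [div_lt_one hτ2]; linarith
  intro Λ hΛ N f hf a ha
  have hΛq : K / q ≤ Λ := (le_max_left _ _).trans hΛ
  have hΛ1 : Λ₁ ≤ Λ := (le_max_left _ _).trans ((le_max_right _ _).trans hΛ)
  have hΛ2 : Λ₂ ≤ Λ := (le_max_right _ _).trans ((le_max_right _ _).trans hΛ)
  have hΛ0 : 0 < Λ := lt_of_lt_of_le (by positivity) hΛq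
  have hN := hf.nonneg hα ⟨a, ha⟩
  have hr := norm_sub_pos hα ha
  set r := ‖a - α‖ with hrdef
  set w := r ^ τ * Real.exp (Λ * r) with hw
  have hw0 : 0 ≤ w := by positivity
  have hPa := hPc a ha
  set p := ‖P.eval (-a)‖ with hp
  have hp0 : 0 ≤ p := norm_nonneg _
  set J := ∫ t in (0 : ℝ)..1, t ^ τ * Real.exp (Λ * r * t) with hJ
  have hJ1 : J ≤ Real.exp (Λ * r) / (τ + 1) := integral_rpow_mul_exp_le hτ1 (by positivity)
  have hJ2 : Λ * r * J ≤ K * Real.exp (Λ * r) := mul_integral_rpow_mul_exp_le hτ1 (by positivity)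
  have hJ0 : 0 ≤ J := intervalIntegral.integral_nonneg zero_le_one fun t ht =>
    mul_nonneg (Real.rpow_nonneg ht.1 τ) (Real.exp_pos _).le
  -- the part with `Q`
  have hQgen : ∀ S, (∀ t ∈ Set.Ioc (0 : ℝ) 1, ‖Q.eval (-(α + (t : ℂ) * (a - α)))‖ ≤ S) →
      ‖baseIntegral α (fun ζ => Q.eval (-ζ) * f ζ) a‖ ≤ S * (N * r ^ τ) * r * J := by
    intro S hS
    refine norm_baseIntegral_le_of_segment hτ1 fun t ht => ?_
    rw [norm_mul, mul_assoc]
    exact mul_le_mul (hS t ht) (hf.norm_segment_le hstar ha ht) (norm_nonneg _)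
      ((norm_nonneg _).trans (hS t ht))
  have hQ : ‖baseIntegral α (fun ζ => Q.eval (-ζ) * f ζ) a‖ ≤
      p * ((τ + 1 / 2) / (τ + 1) * N * w) := by
    rcases lt_or_ge r ρ with hlt | hge
    · refine (hQgen ((τ + 1 / 2) * p / r) fun t ht => ?_).trans ?_
      · rw [le_div_iff₀ hr]
        exact hnear a hlt t (Set.Ioc_subset_Icc_self ht)
      · calc (τ + 1 / 2) * p / r * (N * r ^ τ) * r * J
            = (τ + 1 / 2) * p * (N * r ^ τ) * J := by field_simp
          _ ≤ (τ + 1 / 2) * p * (N * r ^ τ) * (Real.exp (Λ * r) / (τ + 1)) := by gcongr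
          _ = _ := by rw [hw]; ring
    · refine (hQgen (B * (1 + r) ^ Q.natDegree) fun t ht => ?_).trans ?_
      · refine (hB _).trans ?_
        rw [norm_segment_sub ht.1.le]
        have h0 : 0 ≤ t * ‖a - α‖ := mul_nonneg ht.1.le hr.le
        gcongr
        exact mul_le_of_le_one_left hr.le ht.2
      · have h1 : r * J ≤ K * Real.exp (Λ * r) / Λ := by
          rw [le_div_iff₀ hΛ0]; linarith
        have h2 : (1 + r) ^ Q.natDegree ≤ p / (c * ρ) := by
          rw [le_div_iff₀ (by positivity)]
          refine le_trans ?_ hPa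
          have : 0 ≤ (1 + r) ^ Q.natDegree := by positivity
          calc _ = c * ρ * (1 + r) ^ Q.natDegree := by ring
            _ ≤ _ := by gcongr
        have h3 : B * K / (c * ρ) / Λ ≤ (τ + 1 / 2) / (τ + 1) := by
          rw [div_le_div_iff₀ hΛ0 hτ2]
          have h4 := mul_le_mul_of_nonneg_left hΛ1 (show 0 ≤ τ + 1 / 2 by linarith)
          have h5 : (τ + 1 / 2) * Λ₁ = B * K / (c * ρ) * (τ + 1) := by
            rw [hΛ₁]; field_simp
          linarith
        calc B * (1 + r) ^ Q.natDegree * (N * r ^ τ) * r * J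
            = B * (1 + r) ^ Q.natDegree * (N * r ^ τ) * (r * J) := by ring
          _ ≤ B * (p / (c * ρ)) * (N * r ^ τ) * (K * Real.exp (Λ * r) / Λ) := by gcongr
          _ = p * (B * K / (c * ρ) / Λ * N * w) := by rw [hw]; ring
          _ ≤ _ := by gcongr
  -- the part with `R`
  have hR : ‖baseIntegral α (baseIntegral α (seriesOp R α f)) a‖ ≤
      p * (1 / 4 / (τ + 1) * N * w) := by
    -- The two integrations serve different purposes: the inner one gains `K / Λ`, the outer one
    -- gains `r / (τ + 1)`, and this `r` is absorbed by `|P(-a)| ≥ c r`.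
    have h1 := (((hf.seriesOp hq hsum hτ1 hΛq hstar hΩ hα).baseIntegral hτ1 hΛ0 hstar hΩ
      hα).baseIntegral_succ hτ1 hΛ0.le hstar hΩ hα).2 a ha
    refine h1.trans ?_
    have h2 : r ≤ p / c := by
      rw [le_div_iff₀ hc]
      refine le_trans ?_ hPa
      have : 1 ≤ (1 + r) ^ Q.natDegree := one_le_pow₀ (by linarith)
      nlinarith [mul_pos hc hr]
    have h3 : M * K / c / Λ ≤ 1 / 4 := by
      rw [div_le_iff₀ hΛ0]
      have : Λ₂ = 4 * (M * K / c) := by rw [hΛ₂]; ring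
      linarith
    rw [Real.rpow_add hr, Real.rpow_one]
    calc N * M * (K / Λ) / (τ + 1) * (r ^ τ * r * Real.exp (Λ * r))
        = N * M * (K / Λ) / (τ + 1) * w * r := by rw [hw]; ring
      _ ≤ N * M * (K / Λ) / (τ + 1) * w * (p / c) := by gcongr
      _ = p * (M * K / c / Λ / (τ + 1) * N * w) := by ring
      _ ≤ _ := by gcongr
  calc ‖volterraOp Q R α f a‖ ≤ _ := norm_add_le _ _
    _ ≤ p * ((τ + 1 / 2) / (τ + 1) * N * w) + p * (1 / 4 / (τ + 1) * N * w) := add_le_add hQ hR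
    _ = _ := by field_simp; ring

/-! ### Branches of the logarithm and of powers -/

/-- Simple connectivity yields a continuous logarithm; being a local right inverse of `exp`, whose
derivative never vanishes, it is holomorphic. -/
theorem exists_isLogBranch (hΩ : IsOpen Ω) (hΩsc : IsSimplyConnected Ω) (hα : α ∉ Ω) :
    ∃ L, IsLogBranch α Ω L := by
  obtain ⟨L, hLc, hL⟩ := Complex.exists_continuousOn_eqOn_exp_comp hΩsc hΩ
    (g := fun ζ => ζ - α) (by fun_prop)
    (by rintro ⟨ζ, hζ, h⟩; exact hα (sub_eq_zero.1 h ▸ hζ))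
  refine ⟨L, fun a ha => ?_, fun ζ hζ => hL hζ⟩
  have hLa := hLc.continuousAt (hΩ.mem_nhds ha)
  have h2 : HasDerivAt (fun ζ => L (ζ + α)) (Complex.exp (L a))⁻¹ (a - α) := by
    refine HasDerivAt.of_local_left_inverse (f := Complex.exp) ?_ ?_ (Complex.exp_ne_zero _) ?_
    · exact ContinuousAt.comp (g := L) (by simpa using hLa) (by fun_prop)
    · simpa using Complex.hasDerivAt_exp (L a)
    · have hc : ContinuousAt (fun ζ : ℂ => ζ + α) (a - α) := by fun_prop
      filter_upwards [hc.preimage_mem_nhds (hΩ.mem_nhds (by simpa using ha))] with ζ hζ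
      simpa using hL hζ
  have h3 : HasDerivAt L (Complex.exp (L a))⁻¹ a := by
    simpa using h2.comp_sub_const a α
  exact h3.differentiableAt.differentiableWithinAt

variable {L : ℂ → ℂ}

theorem IsLogBranch.hasDerivAt (hL : IsLogBranch α Ω L) (hΩ : IsOpen Ω) {ζ : ℂ} (hζ : ζ ∈ Ω) :
    HasDerivAt L (ζ - α)⁻¹ ζ := by
  have hd := (hL.1.differentiableAt (hΩ.mem_nhds hζ)).hasDerivAt
  have h1 : HasDerivAt (fun z => Complex.exp (L z)) 1 ζ := by
    refine ((hasDerivAt_id ζ).sub_const α).congr_of_eventuallyEq ?_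
    filter_upwards [hΩ.mem_nhds hζ] with z hz using hL.2 z hz
  have h2 := hd.cexp.unique h1
  rw [hL.2 ζ hζ] at h2
  rwa [← eq_inv_of_mul_eq_one_right h2]

/-- Along the ray, `L` and the real logarithm of the parameter both have derivative `1/s`. Hence
every branch of a power is homogeneous along rays and can be integrated explicitly. -/
theorem IsLogBranch.apply_segment (hL : IsLogBranch α Ω L) (hΩ : IsOpen Ω) (hα : α ∉ Ω)
    (hstar : IsStarShapedAround α Ω) {a : ℂ} (ha : a ∈ Ω) {t : ℝ} (h0 : 0 < t) (h1 : t ≤ 1) :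
    L (α + (t : ℂ) * (a - α)) = L a + Real.log t := by
  have hd : ∀ s ∈ Set.Icc t 1,
      HasDerivAt (fun s : ℝ => L (α + (s : ℂ) * (a - α)) - Real.log s) 0 s := by
    intro s hs
    have hs0 : 0 < s := h0.trans_le hs.1
    have h2 : HasDerivAt (fun s : ℝ => α + (s : ℂ) * (a - α)) (a - α) s := by
      simpa using ((hasDerivAt_id s).ofReal_comp.mul_const (a - α)).const_add α
    have h3 := (hL.hasDerivAt hΩ (hstar.add_smul_mem ha hs0 hs.2)).comp s h2
    have h4 := (Real.hasDerivAt_log hs0.ne').ofReal_comp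
    refine (h3.sub h4).congr_deriv ?_
    have hne : a - α ≠ 0 := norm_pos_iff.1 (norm_sub_pos hα ha)
    have hs' : (s : ℂ) ≠ 0 := ofReal_ne_zero.2 hs0.ne'
    push_cast
    field_simp
    ring_nf
  have h2 := constant_of_has_deriv_right_zero
    (fun s hs => (hd s hs).continuousAt.continuousWithinAt)
    (fun s hs => (hd s ⟨hs.1, hs.2.le⟩).hasDerivWithinAt) 1 ⟨h1, le_rfl⟩
  simp at h2
  rw [h2]; ring

theorem IsLogBranch.branchPow_segment (hL : IsLogBranch α Ω L) (hΩ : IsOpen Ω) (hα : α ∉ Ω)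
    (hstar : IsStarShapedAround α Ω) (s : ℝ) {a : ℂ} (ha : a ∈ Ω) {t : ℝ} (h0 : 0 < t)
    (h1 : t ≤ 1) :
    branchPow L s (α + (t : ℂ) * (a - α)) = ((t ^ s : ℝ) : ℂ) * branchPow L s a := by
  rw [branchPow, branchPow, hL.apply_segment hΩ hα hstar ha h0 h1, mul_add, Complex.exp_add,
    Real.rpow_def_of_pos h0]
  push_cast
  rw [mul_comm (Complex.exp _), mul_comm ((Real.log t : ℝ) : ℂ)]

theorem IsLogBranch.hasExpBound_branchPow (hL : IsLogBranch α Ω L) (s : ℝ) :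
    HasExpBound α Ω s 0 1 (branchPow L s) := by
  refine ⟨(hL.1.const_mul _).cexp, fun ζ hζ => le_of_eq ?_⟩
  rw [branchPow, ← hL.2 ζ hζ, Complex.norm_exp, Complex.norm_exp, ← Real.exp_mul]
  simp [mul_comm]

theorem IsLogBranch.baseIntegral_branchPow (hL : IsLogBranch α Ω L) (hΩ : IsOpen Ω) (hα : α ∉ Ω)
    (hstar : IsStarShapedAround α Ω) {s : ℝ} (hs : -1 < s) {a : ℂ} (ha : a ∈ Ω) :
    baseIntegral α (branchPow L s) a = branchPow L s a * (a - α) / ((s + 1 : ℝ) : ℂ) := by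
  have h1 : ∫ t in (0 : ℝ)..1, branchPow L s (α + (t : ℂ) * (a - α)) =
      ∫ t in (0 : ℝ)..1, ((t ^ s : ℝ) : ℂ) * branchPow L s a := by
    refine intervalIntegral.integral_congr_ae (.of_forall fun t ht => ?_)
    rw [Set.uIoc_of_le zero_le_one] at ht
    exact hL.branchPow_segment hΩ hα hstar s ha ht.1 ht.2
  rw [baseIntegral, intervalIntegral.integral_mul_const, h1, intervalIntegral.integral_mul_const,
    intervalIntegral.integral_ofReal, integral_rpow_zero_one hs]
  push_cast
  ring

/-! ### The leading term -/

theorem HasExpBound.sub_mul (hf : HasExpBound α Ω σ Λ C f) (hα : α ∉ Ω) :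
    HasExpBound α Ω (σ + 1) Λ C (fun ζ => (ζ - α) * f ζ) := by
  refine ⟨by have := hf.1; fun_prop, fun ζ hζ => ?_⟩
  rw [norm_mul, Real.rpow_add (norm_sub_pos hα hζ), Real.rpow_one]
  calc _ ≤ ‖ζ - α‖ * (C * (‖ζ - α‖ ^ σ * Real.exp (Λ * ‖ζ - α‖))) := by
        gcongr; exact hf.2 ζ hζ
    _ = _ := by ring

theorem HasExpBound.neg (hf : HasExpBound α Ω σ Λ C f) :
    HasExpBound α Ω σ Λ C (fun ζ => -f ζ) :=
  ⟨hf.1.neg, fun ζ hζ => by rw [norm_neg]; exact hf.2 ζ hζ⟩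

theorem exists_eval_neg_eq (p : ℂ[X]) (α : ℂ) :
    ∃ s : ℂ[X], ∀ ζ, p.eval (-ζ) = p.eval (-α) - (ζ - α) * s.eval (-ζ) := by
  obtain ⟨s, hs⟩ := X_sub_C_dvd_sub_C_eval (a := -α) (p := p)
  refine ⟨s, fun ζ => ?_⟩
  have := congrArg (eval (-ζ)) hs
  simp only [eval_sub, eval_C, eval_mul, eval_X] at this
  linear_combination this

theorem exists_eval_neg_eq_of_isRoot (hα : P.IsRoot (-α)) :
    ∃ s : ℂ[X], ∀ ζ, P.eval (-ζ) =
      -(ζ - α) * (derivative P).eval (-α) + (ζ - α) * ((ζ - α) * s.eval (-ζ)) := by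
  obtain ⟨s₁, hs₁⟩ := dvd_iff_isRoot.2 hα
  obtain ⟨s₂, hs₂⟩ := exists_eval_neg_eq s₁ α
  have hd : (derivative P).eval (-α) = s₁.eval (-α) := by
    rw [hs₁]; simp
  refine ⟨s₂, fun ζ => ?_⟩
  rw [hd]
  have h1 : P.eval (-ζ) = -(ζ - α) * s₁.eval (-ζ) := by
    conv_lhs => rw [hs₁]
    simp only [eval_mul, eval_sub, eval_X, eval_C]
    ring
  rw [h1, hs₂ ζ]
  ring

/-- Division by `P(-ζ)` costs one power of `|ζ - α|`, its zero at `α` being simple. -/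
theorem HasExpBound.div_eval_neg {c : ℝ} (hc : 0 < c) (hα : α ∉ Ω)
    (hP : ∀ ζ ∈ Ω, c * ‖ζ - α‖ ≤ ‖P.eval (-ζ)‖) (hf : HasExpBound α Ω (σ + 1) Λ C f) :
    HasExpBound α Ω σ Λ (C / c) (fun ζ => f ζ / P.eval (-ζ)) := by
  have hd : Differentiable ℂ fun ζ : ℂ => P.eval (-ζ) := P.differentiable.comp differentiable_neg
  have hpos : ∀ ζ ∈ Ω, 0 < c * ‖ζ - α‖ := fun ζ hζ => mul_pos hc (norm_sub_pos hα hζ)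
  refine ⟨hf.1.div hd.differentiableOn fun ζ hζ =>
    norm_pos_iff.1 ((hpos ζ hζ).trans_le (hP ζ hζ)), fun ζ hζ => ?_⟩
  have hr := norm_sub_pos hα hζ
  rw [norm_div]
  calc _ ≤ C * (‖ζ - α‖ ^ (σ + 1) * Real.exp (Λ * ‖ζ - α‖)) / (c * ‖ζ - α‖) :=
        div_le_div₀ ((norm_nonneg _).trans (hf.2 ζ hζ)) (hf.2 ζ hζ) (hpos ζ hζ) (hP ζ hζ)
    _ = _ := by rw [Real.rpow_add hr, Real.rpow_one]; field_simp

/-- The leading terms cancel: the operator maps the power `(ζ - α)^(τ-1)` to a function of order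
`τ + 1`. -/
theorem exists_hasExpBound_positionOp_branchPow {q : ℝ} (hq : 0 < q)
    (hsum : Summable fun j => ‖coeffAt R j‖ * q ^ j)
    (hstar : IsStarShapedAround α Ω) (hΩ : IsOpen Ω) (hα : α ∉ Ω) (hne : Ω.Nonempty)
    {τ : ℝ} (hτpos : 0 < τ) (hPα : P.IsRoot (-α))
    (hτ : Q.eval (-α) = τ * (derivative P).eval (-α)) (hL : IsLogBranch α Ω L) :
    ∃ Λ C, HasExpBound α Ω (τ + 1) Λ C (positionOp P Q R α (branchPow L (τ - 1))) := by
  have hσ : -1 < τ - 1 := by linarith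
  have hσ1 : τ - 1 + 1 = τ := by ring
  set p := branchPow L (τ - 1) with hp
  have hpb : HasExpBound α Ω (τ - 1) 0 1 p := hL.hasExpBound_branchPow _
  obtain ⟨S, hS⟩ := exists_eval_neg_eq_of_isRoot hPα
  obtain ⟨T, hT⟩ := exists_eval_neg_eq Q α
  have hp1 := hpb.sub_mul hα
  rw [hσ1] at hp1
  have hc := gainConst_pos hσ
  have hΛ0 : 0 < gainConst (τ - 1) / q := by positivity
  obtain ⟨Λ₁, C₁, h₁⟩ := (hp1.sub_mul hα).exists_mul_eval_neg S
  obtain ⟨Λ₂, C₂, h₂⟩ := hp1.exists_mul_eval_neg T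
  have h₂' := (h₂.mono (h₂.nonneg hα hne) (le_max_left Λ₂ 0) le_rfl).baseIntegral_succ
    (by linarith) (le_max_right _ _) hstar hΩ hα
  have h₃ := ((hpb.mono zero_le_one hΛ0.le le_rfl).seriesOp hq hsum hσ le_rfl hstar hΩ
    hα).baseIntegral_succ hσ hΛ0.le hstar hΩ hα
  rw [hσ1] at h₃
  have h₃' := h₃.baseIntegral_succ (by linarith) hΛ0.le hstar hΩ hα
  set Λ' := max Λ₁ (max (max Λ₂ 0) (gainConst (τ - 1) / q)) with hΛ'
  have k₁ := h₁.mono (h₁.nonneg hα hne) (le_max_left _ _ : _ ≤ Λ') le_rfl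
  have k₂ := h₂'.mono (h₂'.nonneg hα hne)
    ((le_max_left _ _).trans (le_max_right _ _) : _ ≤ Λ') le_rfl
  have k₃ := h₃'.mono (h₃'.nonneg hα hne)
    ((le_max_right _ _).trans (le_max_right _ _) : _ ≤ Λ') le_rfl
  -- The three remainders, all of order `τ + 1`: the second-order part of `P(-ζ)`, the first-order
  -- part of `Q(-ζ)` after one integration, and the `R` term after two.
  refine ⟨Λ', _, ((k₁.add_const_mul k₂ (-1)).add_const_mul k₃ 1).congr fun a ha => ?_⟩
  have hQ : baseIntegral α (fun ζ => Q.eval (-ζ) * p ζ) a =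
      Q.eval (-α) * (p a * (a - α) / (τ : ℂ)) -
        baseIntegral α (fun ζ => T.eval (-ζ) * ((ζ - α) * p ζ)) a := by
    have hpI := hL.baseIntegral_branchPow hΩ hα hstar hσ ha
    rw [hσ1] at hpI
    obtain ⟨_, _, hQ⟩ := hpb.exists_mul_eval_neg Q
    -- The splitting `Q(-ζ) p + T(-ζ)(ζ - α) p = Q(-α) p` is integrated; the summand `0` only fits
    -- the right side to the form of the linearity lemma.
    have h4 : baseIntegral α (fun ζ => Q.eval (-ζ) * p ζ +
        1 * (T.eval (-ζ) * ((ζ - α) * p ζ))) a = baseIntegral α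
          (fun ζ => 0 + Q.eval (-α) * p ζ) a := by
      congr 1; funext ζ; rw [hT ζ]; ring
    rw [baseIntegral_add_const_mul (hQ.baseIntegrable hσ hstar ha)
      (h₂.baseIntegrable (by linarith) hstar ha),
      baseIntegral_add_const_mul (f := fun _ => 0) (by simp [BaseIntegrable])
        (hpb.baseIntegrable hσ hstar ha), hpI] at h4
    have h0 : baseIntegral α (fun _ => 0) a = 0 := by simp [baseIntegral]
    rw [h0] at h4
    linear_combination h4
  have hτ0 : (τ : ℂ) ≠ 0 := ofReal_ne_zero.2 hτpos.ne'
  rw [positionOp, hQ, hτ, hS a]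
  field_simp
  ring

end LevelOne

/-! ### Existence and uniqueness of the solution -/

open LevelOne in
theorem theorem6
    -- the level-1 operator: P, Q, and R holomorphic on the disk |z| > A around z = ∞ (w = 1 / z)
    (P Q : Polynomial ℂ) (R : ℂ → ℂ) (A : ℝ)
    (hP : P.Monic)
    (hPsimple : ∀ r : ℂ, P.IsRoot r → P.rootMultiplicity r = 1)
    (hQdeg : Q.natDegree + 1 = P.natDegree)
    (hQ : ∀ r : ℂ, P.IsRoot r → Q.eval r ≠ 0)
    (hA : 0 ≤ A)
    (hR : DifferentiableOn ℂ R {w : ℂ | A * ‖w‖ < 1})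
    -- the root -α and the exponent τ
    (α : ℂ) (hα : P.IsRoot (-α))
    (τ : ℝ) (hτ : (τ : ℂ) = Q.eval (-α) / (Polynomial.derivative P).eval (-α))
    (hτpos : 0 < τ)
    -- the domain
    (Ω : Set ℂ) (hΩopen : IsOpen Ω) (hΩsc : IsSimplyConnected Ω)
    (hαΩ : α ∉ Ω) (hstar : LevelOne.IsStarShapedAround α Ω)
    (htouch : α ∈ closure Ω)
    (hother : ∀ β : ℂ, P.IsRoot (-β) → β ≠ α → β ∉ closure Ω) :
    -- the operator is well defined on E^(τ-1)
    (∀ φ ∈ LevelOne.expSpace α Ω (τ - 1), ∀ a ∈ Ω, LevelOne.PositionOpConverges Q R α φ a) ∧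
    -- (ζ - α)^(τ-1) has branches on Ω
    (∃ L : ℂ → ℂ, LevelOne.IsLogBranch α Ω L) ∧
    -- and, for each of them:
    ∀ L : ℂ → ℂ, LevelOne.IsLogBranch α Ω L →
      LevelOne.affineExpSpace α Ω L (τ - 1) τ ⊆ LevelOne.expSpace α Ω (τ - 1) ∧
      ∃ ψ ∈ LevelOne.affineExpSpace α Ω L (τ - 1) τ,
        (∀ a ∈ Ω, LevelOne.positionOp P Q R α ψ a = 0) ∧
        ∀ φ ∈ LevelOne.affineExpSpace α Ω L (τ - 1) τ,
          (∀ a ∈ Ω, LevelOne.positionOp P Q R α φ a = 0) → Set.EqOn φ ψ Ω := by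
  have hσ : -1 < τ - 1 := by linarith
  have hσ1 : τ - 1 + 1 = τ := by ring
  have hτ1 : -1 < τ := by linarith
  have hne := hΩsc.nonempty
  obtain ⟨q, hq, hsum⟩ := exists_summable_norm_coeffAt hA hR
  -- Since division by zero gives zero, a vanishing derivative would force `τ = 0`.
  have hd : (derivative P).eval (-α) ≠ 0 := by
    intro h
    rw [h, div_zero, ofReal_eq_zero] at hτ
    exact hτpos.ne' hτ
  have hτ' : Q.eval (-α) = τ * (derivative P).eval (-α) := by rw [hτ, div_mul_cancel₀ _ hd]
  obtain ⟨c, hc, hPc⟩ :=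
    exists_mul_pow_le_norm_eval_neg hP hQdeg hα (hPsimple _ hα) hother
  have hPc' : ∀ ζ ∈ Ω, c * ‖ζ - α‖ ≤ ‖P.eval (-ζ)‖ := fun ζ hζ =>
    (le_mul_of_one_le_right (by positivity)
      (one_le_pow₀ (by linarith [norm_nonneg (ζ - α)]))).trans (hPc ζ hζ)
  have hPpos : ∀ ζ ∈ Ω, 0 < ‖P.eval (-ζ)‖ := fun ζ hζ =>
    (mul_pos hc (norm_sub_pos hαΩ hζ)).trans_le (hPc' ζ hζ)
  obtain ⟨ρ, hρ, hnear⟩ := exists_pos_norm_eval_segment_mul_le hα hτpos hd hτ'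
  obtain ⟨κ, Λ₀, hκ0, hκ1, hΛ₀, hcontr⟩ :=
    exists_volterraOp_contraction hq hsum hstar hΩopen hαΩ hτpos hc hPc hρ hnear
  have hlift : ∀ {Λ C f}, HasExpBound α Ω τ Λ C f → HasExpBound α Ω (τ - 1) (Λ + 1) C f :=
    fun h => HasExpBound.of_exponent_add (by rwa [hσ1]) (h.nonneg hαΩ hne) hαΩ
  refine ⟨fun φ hφ a ha => ?_, exists_isLogBranch hΩopen hΩsc hαΩ, fun L hL => ?_⟩
  · obtain ⟨Λ, C, h⟩ := mem_expSpace_iff.1 hφ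
    exact h.positionOpConverges hq hsum hσ hstar hΩopen hαΩ Q ha
  set p := branchPow L (τ - 1) with hp
  have hpb : HasExpBound α Ω (τ - 1) 0 1 p := hL.hasExpBound_branchPow _
  -- Linearity of `V` without conditions on the exponential types: both are raised to a common one,
  -- large enough for the series.
  have hlin : ∀ {Λ Λ' C C' f g}, HasExpBound α Ω (τ - 1) Λ C f →
      HasExpBound α Ω (τ - 1) Λ' C' g → ∀ c : ℂ, ∀ a ∈ Ω,
      volterraOp Q R α (fun ζ => f ζ + c * g ζ) a =
        volterraOp Q R α f a + c * volterraOp Q R α g a := by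
    intro Λ Λ' C C' f g hf hg c a ha
    exact volterraOp_add_const_mul hq hsum hσ hstar hΩopen hαΩ
      (le_max_right (max Λ Λ') (gainConst (τ - 1) / q))
      (hf.mono (hf.nonneg hαΩ hne) ((le_max_left _ _).trans (le_max_left _ _)) le_rfl)
      (hg.mono (hg.nonneg hαΩ hne) ((le_max_right _ _).trans (le_max_left _ _)) le_rfl) c Q ha
  have haff : ∀ {φ}, φ ∈ affineExpSpace α Ω L (τ - 1) τ →
      ∃ Λ C, HasExpBound α Ω τ Λ C fun ζ => φ ζ - p ζ := fun h => mem_expSpace_iff.1 h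
  have hsub : ∀ {φ}, φ ∈ affineExpSpace α Ω L (τ - 1) τ →
      ∃ Λ C, HasExpBound α Ω (τ - 1) Λ C φ := by
    intro φ hφ
    obtain ⟨Λ, C, h⟩ := haff hφ
    have h1 := hlift h
    refine ⟨max (Λ + 1) 0, _, ((hpb.mono zero_le_one (le_max_right (Λ + 1) 0)
      le_rfl).add_const_mul (h1.mono (h1.nonneg hαΩ hne) (le_max_left _ _) le_rfl) 1).congr
        fun ζ _ => by ring⟩
  refine ⟨fun φ hφ => mem_expSpace_iff.2 (hsub hφ), ?_⟩
  -- existence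
  obtain ⟨Λg, Cg, hg⟩ := exists_hasExpBound_positionOp_branchPow (Q := Q) hq hsum hstar hΩopen hαΩ
    hne hτpos hα hτ' hL
  rw [← hp] at hg
  set g := positionOp P Q R α p with hgdef
  have hgP := hg.div_eval_neg hc hαΩ hPc'
  set Λ := max Λ₀ Λg with hΛ
  have hΛq : gainConst τ / q ≤ Λ := hΛ₀.trans (le_max_left _ _)
  have hPd : DifferentiableOn ℂ (fun ζ : ℂ => P.eval (-ζ)) Ω :=
    (P.differentiable.comp differentiable_neg).differentiableOn
  have hPne : ∀ ζ ∈ Ω, P.eval (-ζ) ≠ 0 := fun ζ hζ => norm_pos_iff.1 (hPpos ζ hζ)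
  have hquot : ∀ {N f}, HasExpBound α Ω τ Λ N f →
      HasExpBound α Ω τ Λ (κ * N) (fun ζ => volterraOp Q R α f ζ / P.eval (-ζ)) := by
    intro N f hf
    refine ⟨(hf.differentiableOn_volterraOp hq hsum hτ1 hstar hΩopen hαΩ hΛq Q).div hPd hPne,
      fun ζ hζ => ?_⟩
    rw [norm_div, div_le_iff₀' (hPpos ζ hζ)]
    exact hcontr Λ (le_max_left _ _) N f hf ζ hζ
  have hzero : HasExpBound α Ω τ Λ 0 (fun _ => 0) := ⟨differentiableOn_const _, by simp⟩
  -- The source `g` drops out of differences of `T`, leaving `-V / P(-ζ)`, which `hquot` bounds by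
  -- `κ`.
  obtain ⟨f, C, hfb, hfix⟩ := exists_eqOn_of_contraction (α := α) (σ := τ) (Λ := Λ) hΩopen hαΩ
    (T := fun f ζ => -(volterraOp Q R α f ζ + g ζ) / P.eval (-ζ)) hκ0 hκ1
    (fun f₁ f₂ C₁ C₂ N h₁ h₂ h => (hquot h).neg.congr fun ζ hζ => by
      have h3 := hlin (hlift h₁) (hlift h₂) (-1) ζ hζ
      have h4 : (fun ζ => f₁ ζ + -1 * f₂ ζ) = fun ζ => f₁ ζ - f₂ ζ := by funext; ring
      rw [h4] at h3
      simp only [h3]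
      ring)
    (((hquot hzero).add_const_mul
      (hgP.mono (hgP.nonneg hαΩ hne) (le_max_right Λ₀ Λg) le_rfl) 1).neg.congr
        fun ζ _ => by ring)
  set ψ : ℂ → ℂ := fun ζ => p ζ + 1 * f ζ with hψ
  have hψmem : ψ ∈ affineExpSpace α Ω L (τ - 1) τ :=
    mem_expSpace_iff.2 ⟨Λ, C, hfb.congr fun ζ _ => by simp [hψ, hp]⟩
  have hψ0 : ∀ a ∈ Ω, positionOp P Q R α ψ a = 0 := by
    intro a ha
    rw [positionOp_eq, hlin hpb (hlift hfb) 1 a ha]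
    have h1 := hfix ha
    have h2 : g a = _ := positionOp_eq P Q R α p a
    simp only at h1
    rw [div_eq_iff (hPne a ha)] at h1
    linear_combination -h1 - h2
  refine ⟨ψ, hψmem, hψ0, fun φ hφ hφ0 a ha => ?_⟩
  -- uniqueness
  obtain ⟨Λ₁, C₁, h₁⟩ := haff hφ
  obtain ⟨_, _, hφb⟩ := hsub hφ
  obtain ⟨_, _, hψb⟩ := hsub hψmem
  -- The powers cancel in `φ - ψ = (φ - p) - f`, so the difference is in `E^τ`. Its type may exceed
  -- `Λ`; the contraction bound holds with the same `κ` for every type at least `Λ₀`.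
  have hdiff : HasExpBound α Ω τ (max Λ₁ Λ) (C₁ + ‖(-1 : ℂ)‖ * C) (fun ζ => φ ζ + -1 * ψ ζ) :=
    ((h₁.mono (h₁.nonneg hαΩ hne) (le_max_left _ _) le_rfl).add_const_mul
      (hfb.mono (hfb.nonneg hαΩ hne) (le_max_right _ _) le_rfl) (-1)).congr
        fun ζ _ => by simp only [hψ]; ring
  set N := C₁ + ‖(-1 : ℂ)‖ * C
  have heq : ∀ ζ ∈ Ω, P.eval (-ζ) * (φ ζ + -1 * ψ ζ) =
      -volterraOp Q R α (fun ζ => φ ζ + -1 * ψ ζ) ζ := by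
    intro ζ hζ
    have e1 := hφ0 ζ hζ
    have e2 := hψ0 ζ hζ
    rw [positionOp_eq] at e1 e2
    rw [hlin hφb hψb (-1) ζ hζ]
    linear_combination e1 - e2
  -- The difference `D` satisfies `P(-ζ) D = -V D`, so a bound with constant `N` implies one with `κ
  -- N`.
  have hiter : ∀ n : ℕ, HasExpBound α Ω τ (max Λ₁ Λ) (κ ^ n * N) (fun ζ => φ ζ + -1 * ψ ζ) := by
    intro n
    induction n with
    | zero => simpa using hdiff
    | succ n ih =>
      refine ⟨hdiff.1, fun ζ hζ => ?_⟩
      have h3 := hcontr _ ((le_max_left _ _).trans (le_max_right _ _)) _ _ ih ζ hζ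
      rw [← norm_neg, ← heq ζ hζ, norm_mul] at h3
      rw [pow_succ', mul_assoc κ]
      exact le_of_mul_le_mul_left h3 (hPpos ζ hζ)
  have hlim : Filter.Tendsto (fun n : ℕ => κ ^ n * N *
      (‖a - α‖ ^ τ * Real.exp (max Λ₁ Λ * ‖a - α‖))) Filter.atTop (nhds 0) := by
    simpa using ((tendsto_pow_atTop_nhds_zero_of_lt_one hκ0 hκ1).mul_const N).mul_const
      (‖a - α‖ ^ τ * Real.exp (max Λ₁ Λ * ‖a - α‖))
  have h4 := norm_le_zero_iff.1 (ge_of_tendsto' hlim fun n => (hiter n).2 a ha)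
  linear_combination h4
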